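/- Let $\beta\in\{1,2\}$, let $\mathbb F=\mathbb R$ if $\beta=1$ and $\mathbb F=\mathbb C$ if $\beta=2$, and let $r\ge 2$, $n\ge 1$ be integers and $s$ a real number. For $\lambda=(\lambda_1,\dots,\lambda_{rn})\in\mathbb R^{rn}$ and an $rn\times rn$ matrix $X=(x_{a,b})$ over $\mathbb F$, let $\mathbf M(\lambda,X)$ be the $rn\times rn$ matrix with entries $$M_{i,j}=\lambda_i^{\lfloor (j-1)/r\rfloor}\,x_{\,j-r\lfloor (j-1)/r\rfloor,\;i},\qquad 1\le i,j\le rn$$ (with $0^0=1$), which depends only on the first $r$ rows of $X$. Let $\mathcal P_{r,n}$ be the set of ordered $r$-tuples $(\mathcal A_1,\dots,\mathcal A_r)$ of pairwise disjoint subsets of $\{1,\dots,rn\}$, each of cardinality $n$, whose union is $\{1,\dots,rn\}$. For $\mathcal A\subset\{1,\dots,rn\}$ let $\Delta(\mathcal A)=\prod_{i<j,\ i,j\in\mathcal A}(\lambda_j-\lambda_i)$ be the Vandermonde determinant in the variables $\lambda_i$, $i\in\mathcal A$. Let $Q$ be distributed according to the Haar probability measure on the group of $rn\times rn$ orthogonal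 matrices (if $\beta=1$) or unitary matrices (if $\beta=2$). Then, for every $\lambda\in\mathbb R^{rn}$, $|\det \mathbf M(\lambda,Q)|^{\beta s}$ is integrable in both of the following cases, and $$\mathbb E\,|\det \mathbf M(\lambda,Q)|^{\beta s}=c_{n,\beta,r,\beta s}\times\begin{cases}\displaystyle\sum_{(\mathcal A_1,\dots,\mathcal A_r)\in\mathcal P_{r,n}}\ \prod_{j=1}^r\Delta(\mathcal A_j)^2, & r\ge 2,\ \beta s=2,\\[10pt] \displaystyle\sum_{(\mathcal A,\mathcal A')\in\mathcal P_{2,n}}\Delta(\mathcal A)^4\,\Delta(\mathcal A')^4, & r=2,\ \beta s=4,\end{cases}$$ where $$c_{n,\beta,r,\beta s}=\left(\tfrac{\beta}{2}\right)^{\frac{\beta}{2}rsn}\ \prod_{i=1}^{r}\frac{\Gamma\!\left(\frac{\beta}{2}(rn+1-i)\right)}{\Gamma\!\left(\frac{\beta}{2}((r+s)n+1-i)\right)}\times\begin{cases}1, & r\ge 2,\ \beta s=2,\\ (12/\beta)^n, & r=2,\ \beta s=4.\end{cases}$$ -/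

import Mathlib

open MeasureTheory

noncomputable section

namespace BlockMoment

/-- The real orthogonal group (for `𝕜 = ℝ`) and the complex unitary group (for `𝕜 = ℂ`)
in dimension `m`. -/
abbrev UGroup (𝕜 : Type) [RCLike 𝕜] (m : ℕ) : Type :=
  ↥(Matrix.unitaryGroup (Fin m) 𝕜)

instance instCompactSpaceUGroup (𝕜 : Type) [RCLike 𝕜] (m : ℕ) : CompactSpace (UGroup 𝕜 m) := by
  apply isCompact_iff_compactSpace.mp
  have hK : IsCompact (Set.univ.pi fun _ : Fin m => Set.univ.pi fun _ : Fin m =>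
      Metric.closedBall (0 : 𝕜) 1) :=
    isCompact_univ_pi fun _ => isCompact_univ_pi fun _ => isCompact_closedBall _ _
  have hc : IsClosed ((Matrix.unitaryGroup (Fin m) 𝕜 : Set (Matrix (Fin m) (Fin m) 𝕜))) := by
    have h : (Matrix.unitaryGroup (Fin m) 𝕜 : Set (Matrix (Fin m) (Fin m) 𝕜))
        = {U | U * star U = 1} := by
      ext U
      exact Matrix.mem_unitaryGroup_iff
    rw [h]
    exact isClosed_eq (by fun_prop) continuous_const
  refine hK.of_isClosed_subset hc ?_
  intro U hU i _ j _
  simpa using entry_norm_bound_of_unitary hU i j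

instance instMeasurableSpaceUGroup (𝕜 : Type) [RCLike 𝕜] (m : ℕ) :
    MeasurableSpace (UGroup 𝕜 m) := borel _

instance instBorelSpaceUGroup (𝕜 : Type) [RCLike 𝕜] (m : ℕ) : BorelSpace (UGroup 𝕜 m) := ⟨rfl⟩

/-- The Haar probability measure on the orthogonal / unitary group in dimension `m`: the law of
a Haar distributed `𝕜`-unitary matrix. -/
def haarU (𝕜 : Type) [RCLike 𝕜] (m : ℕ) : Measure (UGroup 𝕜 m) :=
  Measure.haarMeasure ⊤

instance instIsHaarMeasureHaarU (𝕜 : Type) [RCLike 𝕜] (m : ℕ) : (haarU 𝕜 m).IsHaarMeasure := by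
  unfold haarU
  infer_instance

instance instIsProbabilityMeasureHaarU (𝕜 : Type) [RCLike 𝕜] (m : ℕ) :
    IsProbabilityMeasure (haarU 𝕜 m) := by
  constructor
  have h := Measure.haarMeasure_self (K₀ := (⊤ : TopologicalSpace.PositiveCompacts (UGroup 𝕜 m)))
  simpa [haarU] using h

/-- The `rn × rn` matrix `M(λ, X)` built from the first `r` rows of the `rn × rn` matrix `X`.
With indices starting at `0`, its entries are `M i j = λ i ^ (j / r) * X (j % r) i`. -/
def magicMatrix (𝕜 : Type) [RCLike 𝕜] (r n : ℕ) (lam : Fin (r * n) → ℝ)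
    (X : Matrix (Fin (r * n)) (Fin (r * n)) 𝕜) : Matrix (Fin (r * n)) (Fin (r * n)) 𝕜 :=
  Matrix.of fun i j =>
    ((lam i : ℝ) : 𝕜) ^ ((j : ℕ) / r) * X ⟨(j : ℕ) % r, (Nat.mod_le _ _).trans_lt j.isLt⟩ i

/-- `E |det M(λ, Q)| ^ p = v` for `Q` Haar distributed: the random variable is integrable and its
expectation is `v`. -/
def HasDetMoment (𝕜 : Type) [RCLike 𝕜] (r n : ℕ) (lam : Fin (r * n) → ℝ) (p v : ℝ) : Prop :=
  Integrable (fun Q : UGroup 𝕜 (r * n) =>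
      ‖(magicMatrix 𝕜 r n lam (Q : Matrix (Fin (r * n)) (Fin (r * n)) 𝕜)).det‖ ^ p)
    (haarU 𝕜 (r * n)) ∧
  ∫ Q : UGroup 𝕜 (r * n),
      ‖(magicMatrix 𝕜 r n lam (Q : Matrix (Fin (r * n)) (Fin (r * n)) 𝕜)).det‖ ^ p
    ∂(haarU 𝕜 (r * n)) = v

/-- The Vandermonde determinant of the variables `λ a`, `a ∈ A`, with the indices `a` taken in
increasing order. -/
def vdm {N : ℕ} (lam : Fin N → ℝ) (A : Finset (Fin N)) : ℝ :=
  (Matrix.vandermonde fun a : Fin A.card => lam (A.orderEmbOfFin rfl a)).det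

/-- The ordered partitions `(A 0, …, A (r - 1))` of an `rn`-element set into `r` parts of
cardinality `n`. -/
def equipartitions (r n : ℕ) : Finset (Fin r → Finset (Fin (r * n))) :=
  Finset.univ.filter fun A =>
    (∀ j, (A j).card = n) ∧ (∀ j k, j ≠ k → Disjoint (A j) (A k)) ∧
      Finset.univ.biUnion A = Finset.univ

/-- The Gamma-product constant
`(β/2)^(β r s n / 2) ∏_{i=1}^r Γ(β/2 (rn+1-i)) / Γ(β/2 ((r+s)n+1-i))`. -/
def gammaConst (n : ℕ) (β : ℝ) (r : ℕ) (s : ℝ) : ℝ :=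
  (β / 2) ^ (β / 2 * r * s * n) *
    ∏ i ∈ Finset.Icc 1 r,
      Real.Gamma (β / 2 * (r * n + 1 - i)) / Real.Gamma (β / 2 * ((r + s) * n + 1 - i))

end BlockMoment

end

/-! Indexing columns by pairs (k, l) turns `det M` into `blockDet`, which depends only on the first
r rows of Q. Multiplying all row vectors `x i` by G on the right multiplies it by `det G ^ n`
(`blockDet_vecMul`). With N = rn, an r × N Gaussian matrix is a square matrix T times the top rows
of a unitary matrix. Averaging over the group therefore splits the Gaussian moment of order 2k into
the moment of order nk of the Gram determinant times the Haar moment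
(`lintegral_blockDet_pow_eq_mul`). The Gram factor is a product of χ² moments
(`lintegral_gramDet_pow`), and these produce the Gamma quotients. The Gaussian moment remains.

The N columns of the Gaussian matrix are independent, and `|blockDet| ^ (2k)` has bidegree (k, k) in
each of them. So the Gaussian law may be replaced by any finite weighted set of vectors with the
same moments of bidegree (k, k) (`integral_norm_blockDet_pow`). On unit vectors `blockDet` vanishes
unless each vector occurs n times, and is then a product of r Vandermonde determinants up to sign;
the sum over assignments becomes a sum over equipartitions (`sum_norm_blockDet_single_pow`). For k =
1 weighted unit vectors do match the Gaussian moments, which settles βs = 2.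

For k = 2 and r = 2 they do not match, but the fourth moment depends on the column law only through
a factor `pairMoment ^ n` (`discreteMoment_four_universal`). It is a symmetric polynomial in 2n
variables, of degree at most 4(n - 1) in each. When two variables coincide it reduces to the same
moment for n - 1. The cross-multiplied difference for two laws thus vanishes on all diagonals by
induction, hence to second order by symmetry: 2(2n - 1) roots in one variable, more than its degree.
A quadrature with the Gaussian fourth moments has `pairMoment = 24 β³`, the unit vectors have 2, and
the ratio gives `(12 / β) ^ n`. -/

namespace BlockMoment
open Matrix Kronecker

/-! ### The block determinant and its row and column operations. -/

section Algebra

variable {R : Type*} [CommRing R] {n r : ℕ}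

/-- The determinant of the matrix with rows `(lam i ^ k * x i l)`, the columns being indexed by
pairs `(k, l)`. -/
def blockDet (lam : Fin n × Fin r → R) (x : Fin n × Fin r → Fin r → R) : R :=
  (Matrix.of fun i j : Fin n × Fin r => lam i ^ (j.1 : ℕ) * x i j.2).det

/-- Recombining the powers by `E` and the columns by `G`. -/
lemma det_recombine (lam : Fin n × Fin r → R) (x : Fin n × Fin r → Fin r → R)
    (E : Matrix (Fin n) (Fin n) R) (G : Matrix (Fin r) (Fin r) R) :
    (Matrix.of fun i j : Fin n × Fin r =>
      (∑ k : Fin n, lam i ^ (k : ℕ) * E k j.1) * (x i ᵥ* G) j.2).det =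
      E.det ^ r * G.det ^ n * blockDet lam x := by
  have h : (Matrix.of fun i j : Fin n × Fin r =>
      (∑ k : Fin n, lam i ^ (k : ℕ) * E k j.1) * (x i ᵥ* G) j.2) =
      (Matrix.of fun i j : Fin n × Fin r => lam i ^ (j.1 : ℕ) * x i j.2) * (E ⊗ₖ G) := by
    ext i j
    simp only [Matrix.of_apply, Matrix.mul_apply, Fintype.sum_prod_type, kroneckerMap_apply,
      Matrix.vecMul, dotProduct, Finset.sum_mul_sum]
    refine Finset.sum_congr rfl fun k _ => Finset.sum_congr rfl fun l _ => ?_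
    ring
  rw [h, det_mul, det_kronecker, blockDet]
  simp
  ring

lemma blockDet_vecMul (lam : Fin n × Fin r → R) (x : Fin n × Fin r → Fin r → R)
    (G : Matrix (Fin r) (Fin r) R) :
    blockDet lam (fun i => x i ᵥ* G) = G.det ^ n * blockDet lam x := by
  have h := det_recombine lam x 1 G
  simpa [blockDet, Matrix.one_apply] using h

lemma blockDet_comp_perm (lam : Fin n × Fin r → R) (x : Fin n × Fin r → Fin r → R)
    (σ : Equiv.Perm (Fin n × Fin r)) :
    blockDet (lam ∘ σ) (x ∘ σ) = (Equiv.Perm.sign σ : ℤ) * blockDet lam x := by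
  rw [blockDet, blockDet, ← Matrix.det_permute]
  rfl

/-- The bidiagonal matrix of the change of basis from `1, T, …` to `1, T - a, (T - a) T, …`. -/
def shiftMatrix (n : ℕ) (a : R) : Matrix (Fin n) (Fin n) R :=
  Matrix.of fun i j => if i = j then 1 else if (i : ℕ) + 1 = j then -a else 0

lemma det_shiftMatrix (a : R) : (shiftMatrix n a).det = 1 := by
  rw [Matrix.det_of_isUpperTriangular]
  · simp [shiftMatrix]
  · intro i j hij
    simp only [id] at hij
    have h1 : i ≠ j := by rintro rfl; exact lt_irrefl _ hij
    have h2 : (i : ℕ) + 1 ≠ j := by have := Fin.lt_def.1 hij; omega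
    simp [shiftMatrix, h1, h2]

lemma sum_pow_mul_shiftMatrix_zero (t a : R) :
    ∑ k : Fin (n + 1), t ^ (k : ℕ) * shiftMatrix (n + 1) a k 0 = 1 := by
  rw [Finset.sum_eq_single 0]
  · simp [shiftMatrix]
  · intro b _ hb
    simp [shiftMatrix, hb]
  · simp

lemma sum_pow_mul_shiftMatrix_succ (t a : R) (j : Fin n) :
    ∑ k : Fin (n + 1), t ^ (k : ℕ) * shiftMatrix (n + 1) a k j.succ = (t - a) * t ^ (j : ℕ) := by
  have hne : j.castSucc ≠ j.succ := (Fin.castSucc_lt_succ).ne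
  rw [Finset.sum_eq_add_of_mem j.castSucc j.succ (Finset.mem_univ _) (Finset.mem_univ _) hne]
  · simp [shiftMatrix, hne]
    ring
  · intro c _ hc
    have h2 : (c : ℕ) + 1 ≠ j.succ := by
      intro h
      apply hc.1
      ext
      simpa using h
    have h2' : ¬ (c : ℕ) = j := by simpa using h2
    simp [shiftMatrix, hc.2, h2']

/-- The index set of `n + 1` blocks as the first block and the others. -/
def blockSplit (n r : ℕ) : Fin r ⊕ (Fin n × Fin r) ≃ Fin (n + 1) × Fin r where
  toFun := Sum.elim (fun l => (0, l)) (fun p => (p.1.succ, p.2))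
  invFun p := Fin.cases (Sum.inl p.2) (fun k => Sum.inr (k, p.2)) p.1
  left_inv := by rintro (l | p) <;> simp
  right_inv := by
    rintro ⟨k, l⟩
    cases k using Fin.cases <;> simp

/-- In the basis 1, T - a, (T - a) T, … every power except the first vanishes at a, so the matrix
becomes block lower triangular. The rows of the second diagonal block share the factor `lam - a`. -/
lemma blockDet_of_eq_on_first (lam : Fin (n + 1) × Fin r → R)
    (x : Fin (n + 1) × Fin r → Fin r → R) (a : R) (h : ∀ l, lam (0, l) = a) :
    blockDet lam x = (Matrix.of fun i j => x (0, i) j).det *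
      ((∏ i : Fin n × Fin r, (lam (i.1.succ, i.2) - a)) *
        blockDet (fun i => lam (i.1.succ, i.2)) (fun i => x (i.1.succ, i.2))) := by
  have h1 := det_recombine lam x (shiftMatrix (n + 1) a) 1
  rw [det_shiftMatrix] at h1
  simp only [one_pow, det_one, one_mul, vecMul_one] at h1
  rw [← h1, ← Matrix.det_submatrix_equiv_self (blockSplit n r)]
  have h2 : (Matrix.of fun i j : Fin (n + 1) × Fin r =>
      (∑ k : Fin (n + 1), lam i ^ (k : ℕ) * shiftMatrix (n + 1) a k j.1) * x i j.2).submatrix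
        (blockSplit n r) (blockSplit n r) =
      Matrix.fromBlocks (Matrix.of fun i j => x (0, i) j) 0
        (Matrix.of fun i j => x (i.1.succ, i.2) j)
        (Matrix.of fun i j : Fin n × Fin r => (lam (i.1.succ, i.2) - a) *
          (Matrix.of fun i j : Fin n × Fin r =>
            lam (i.1.succ, i.2) ^ (j.1 : ℕ) * x (i.1.succ, i.2) j.2) i j) := by
    ext (i | i) (j | j) <;>
      simp only [blockSplit, Matrix.submatrix_apply, Matrix.of_apply, Equiv.coe_fn_mk,
        Sum.elim_inl, Sum.elim_inr, Matrix.fromBlocks_apply₁₁, Matrix.fromBlocks_apply₁₂,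
        Matrix.fromBlocks_apply₂₁, Matrix.fromBlocks_apply₂₂, sum_pow_mul_shiftMatrix_zero,
        sum_pow_mul_shiftMatrix_succ, h, sub_self, zero_mul, one_mul, Matrix.zero_apply, mul_assoc]
  rw [h2, Matrix.det_fromBlocks_zero₁₂, Matrix.det_mul_column]
  rfl

/-- Expansion by permutations. -/
lemma blockDet_eq_sum (lam : Fin n × Fin r → R) (x : Fin n × Fin r → Fin r → R) :
    blockDet lam x = ∑ σ : Equiv.Perm (Fin n × Fin r),
      ((Equiv.Perm.sign σ : ℤ) : R) * (∏ i, lam i ^ ((σ i).1 : ℕ)) * ∏ i, x i (σ i).2 := by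
  rw [blockDet, ← Matrix.det_transpose, Matrix.det_apply']
  refine Finset.sum_congr rfl fun σ _ => ?_
  simp [Finset.prod_mul_distrib, mul_assoc]

end Algebra

end BlockMoment

namespace BlockMoment
open Matrix

/-! ### Unit-vector columns and equipartitions. -/

section UnitVectors

variable {R : Type*} [CommRing R] {n r : ℕ}

lemma exists_perm_of_blockDet_single_ne_zero (lam : Fin n × Fin r → R)
    (f : Fin n × Fin r → Fin r) (h : blockDet lam (fun i => Pi.single (f i) 1) ≠ 0) :
    ∃ σ : Equiv.Perm (Fin n × Fin r), ∀ i, (σ i).2 = f i := by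
  rw [blockDet_eq_sum] at h
  obtain ⟨σ, -, hσ⟩ := Finset.exists_ne_zero_of_sum_ne_zero h
  refine ⟨σ, fun i => ?_⟩
  by_contra hne
  apply hσ
  have h0 : ∏ i, (Pi.single (f i) 1 : Fin r → R) (σ i).2 = 0 :=
    Finset.prod_eq_zero (Finset.mem_univ i) (Pi.single_eq_of_ne hne 1)
  rw [h0, mul_zero]

/-- Row (k, l) meets only columns with second index l, so the matrix is block diagonal with
Vandermonde blocks. -/
lemma blockDet_single_snd (lam : Fin n × Fin r → R) :
    blockDet lam (fun i => Pi.single i.2 1) =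
      ∏ l, (Matrix.vandermonde fun k => lam (k, l)).det := by
  rw [← Matrix.det_blockDiagonal, blockDet]
  congr 1
  ext ⟨k, l⟩ ⟨k', l'⟩
  by_cases h : l = l'
  · subst h
    simp [Matrix.blockDiagonal_apply, Matrix.vandermonde]
  · simp [Matrix.blockDiagonal_apply, h, Pi.single_apply, Ne.symm h]

end UnitVectors

lemma vdm_eq_of_card {N n : ℕ} (lam : Fin N → ℝ) (A : Finset (Fin N)) (h : A.card = n) :
    vdm lam A = (Matrix.vandermonde fun k : Fin n => lam (A.orderEmbOfFin h k)).det := by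
  subst h
  rfl

variable {𝕜 : Type} [RCLike 𝕜] {n r : ℕ}

lemma norm_blockDet_comp_perm (lam : Fin n × Fin r → 𝕜) (x : Fin n × Fin r → Fin r → 𝕜)
    (σ : Equiv.Perm (Fin n × Fin r)) :
    ‖blockDet (lam ∘ σ) (x ∘ σ)‖ = ‖blockDet lam x‖ := by
  rw [blockDet_comp_perm, norm_mul]
  rcases Int.units_eq_one_or (Equiv.Perm.sign σ) with h | h <;> simp [h]

/-- Listing each fibre of f in increasing order permutes the rows into the block diagonal situation;
the permutation costs only a sign. -/
lemma norm_blockDet_single_of_card (lam : Fin (r * n) → ℝ) (e : Fin n × Fin r ≃ Fin (r * n))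
    (f : Fin (r * n) → Fin r) (hf : ∀ l, (Finset.univ.filter fun i => f i = l).card = n) :
    ‖blockDet (fun i => (lam (e i) : 𝕜)) (fun i => Pi.single (f (e i)) 1)‖ =
      ∏ l, |vdm lam (Finset.univ.filter fun i => f i = l)| := by
  let g : Fin n × Fin r → Fin (r * n) := fun p =>
    (Finset.univ.filter fun i => f i = p.2).orderEmbOfFin (hf p.2) p.1
  have hfg : ∀ p, f (g p) = p.2 := fun p => by
    exact (Finset.mem_filter.1 (Finset.orderEmbOfFin_mem
      (Finset.univ.filter fun i => f i = p.2) (hf p.2) p.1)).2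
  have hg : Function.Injective g := by
    rintro ⟨k, l⟩ ⟨k', l'⟩ h
    have hl : l = l' := (hfg (k, l)).symm.trans ((congrArg f h).trans (hfg (k', l')))
    subst hl
    have hk : k = k' :=
      (Finset.orderEmbOfFin (Finset.univ.filter fun i => f i = l) (hf l)).injective h
    rw [hk]
  have hgb : Function.Bijective g := by
    rw [Fintype.bijective_iff_injective_and_card]
    exact ⟨hg, by simp [mul_comm]⟩
  let σ : Equiv.Perm (Fin n × Fin r) := (Equiv.ofBijective g hgb).trans e.symm
  have hσ : ∀ i, e (σ i) = g i := fun i => by simp [σ]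
  rw [← norm_blockDet_comp_perm _ _ σ]
  have h1 : ((fun i => (lam (e i) : 𝕜)) ∘ σ) = fun i => (lam (g i) : 𝕜) := by
    funext i; simp [hσ]
  have h2 : ((fun i => Pi.single (f (e i)) 1) ∘ σ : Fin n × Fin r → Fin r → 𝕜) =
      fun i => Pi.single i.2 1 := by
    funext i; simp [hσ, hfg]
  rw [h1, h2, blockDet_single_snd, norm_prod]
  refine Finset.prod_congr rfl fun l _ => ?_
  rw [vdm_eq_of_card lam _ (hf l)]
  have : (Matrix.vandermonde fun k => (lam (g (k, l)) : 𝕜)) =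
      (Matrix.vandermonde fun k => lam (g (k, l))).map (algebraMap ℝ 𝕜) := by
    ext i j; simp [Matrix.vandermonde]
  rw [this, ← RingHom.mapMatrix_apply, ← RingHom.map_det, norm_algebraMap', Real.norm_eq_abs]

/-- A nonzero term of the permutation expansion matches the fibre over l with the n columns (k, l).
-/
lemma card_fibre_of_blockDet_ne_zero (lam : Fin n × Fin r → 𝕜) (e : Fin n × Fin r ≃ Fin (r * n))
    (f : Fin (r * n) → Fin r) (h : blockDet lam (fun i => Pi.single (f (e i)) 1) ≠ 0) (l : Fin r) :
    (Finset.univ.filter fun i => f i = l).card = n := by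
  obtain ⟨σ, hσ⟩ := exists_perm_of_blockDet_single_ne_zero lam _ h
  have h1 : (Finset.univ.filter fun i => f i = l) =
      Finset.univ.image fun k : Fin n => e (σ.symm (k, l)) := by
    ext i
    simp only [Finset.mem_filter, Finset.mem_univ, true_and, Finset.mem_image]
    constructor
    · intro hi
      refine ⟨(σ (e.symm i)).1, ?_⟩
      have h2 : ((σ (e.symm i)).1, l) = σ (e.symm i) := by
        ext
        · rfl
        · rw [hσ]; simp [hi]
      rw [h2]; simp
    · rintro ⟨k, rfl⟩
      rw [← hσ]; simp
  rw [h1, Finset.card_image_of_injective _ fun a b hab => by simpa using hab, Finset.card_univ,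
    Fintype.card_fin]

/-- The surviving assignments have all fibres of size n, and such assignments correspond to
equipartitions by taking fibres. -/
theorem sum_norm_blockDet_single_pow (lam : Fin (r * n) → ℝ) (e : Fin n × Fin r ≃ Fin (r * n))
    {p : ℕ} (hp : p ≠ 0) :
    ∑ f : Fin n × Fin r → Fin r,
        ‖blockDet (fun i => (lam (e i) : 𝕜)) (fun i => Pi.single (f i) 1)‖ ^ p =
      ∑ A ∈ equipartitions r n, ∏ j, |vdm lam (A j)| ^ p := by
  rw [← (Equiv.arrowCongr e.symm (Equiv.refl (Fin r))).sum_comp]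
  simp only [Equiv.arrowCongr_apply, Equiv.coe_refl, Function.comp_apply, Equiv.symm_symm, id_eq]
  have hvan : ∀ f ∈ (Finset.univ : Finset (Fin (r * n) → Fin r)),
      f ∉ Finset.univ.filter (fun f : Fin (r * n) → Fin r =>
        ∀ l, (Finset.univ.filter fun i => f i = l).card = n) →
      ‖blockDet (fun i => (lam (e i) : 𝕜)) (fun i => Pi.single (f (e i)) 1)‖ ^ p = 0 := by
    intro f _ hf
    by_contra hne
    apply hf
    rw [Finset.mem_filter]
    refine ⟨Finset.mem_univ _, card_fibre_of_blockDet_ne_zero (fun i => (lam (e i) : 𝕜)) e f ?_⟩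
    intro h0
    exact hne (by rw [h0, norm_zero, zero_pow hp])
  rw [← Finset.sum_subset (Finset.subset_univ _) hvan]
  refine Finset.sum_bij (fun f _ => fun l => Finset.univ.filter fun i => f i = l) ?_ ?_ ?_ ?_
  · intro f hf
    simp only [Finset.mem_filter, Finset.mem_univ, true_and] at hf
    simp only [equipartitions, Finset.mem_filter, Finset.mem_univ, true_and]
    refine ⟨hf, ?_, ?_⟩
    · intro j k hjk
      rw [Finset.disjoint_left]
      intro i hi hi'
      simp only [Finset.mem_filter, Finset.mem_univ, true_and] at hi hi'
      exact hjk (hi ▸ hi')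
    · ext i
      simp
  · intro f _ f' _ h
    funext i
    have h1 := congrFun h (f' i)
    have h2 : i ∈ Finset.univ.filter fun j => f' j = f' i := by simp
    rw [← h1] at h2
    simpa using h2
  · intro A hA
    simp only [equipartitions, Finset.mem_filter, Finset.mem_univ, true_and] at hA
    obtain ⟨hc, hd, hu⟩ := hA
    have hex : ∀ i, ∃ l, i ∈ A l := fun i => by
      have : i ∈ Finset.univ.biUnion A := hu ▸ Finset.mem_univ i
      simpa using this
    choose f hf using hex
    have hfA : (fun l => Finset.univ.filter fun i => f i = l) = A := by
      funext l
      ext i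
      simp only [Finset.mem_filter, Finset.mem_univ, true_and]
      constructor
      · rintro rfl; exact hf i
      · intro hi
        by_contra hne
        exact Finset.disjoint_left.1 (hd _ _ hne) (hf i) hi
    refine ⟨f, ?_, hfA⟩
    simp only [Finset.mem_filter, Finset.mem_univ, true_and]
    intro l
    exact (congrArg Finset.card (congrFun hfA l)).trans (hc l)
  · intro f hf
    simp only [Finset.mem_filter, Finset.mem_univ, true_and] at hf
    rw [norm_blockDet_single_of_card lam e f hf, Finset.prod_pow]

end BlockMoment

namespace BlockMoment
open Matrix Polynomial

/-! ### Symmetric functions vanishing on the diagonals. -/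

section Symmetric

lemma exists_perm_apply_eq {α : Type*} [DecidableEq α] {a b i j : α} (hab : a ≠ b) (hij : i ≠ j) :
    ∃ σ : Equiv.Perm α, σ a = i ∧ σ b = j := by
  refine ⟨(Equiv.swap a i).trans (Equiv.swap (Equiv.swap a i b) j), ?_, ?_⟩
  · have h1 : i ≠ Equiv.swap a i b := fun h => hab (by
      have := congrArg (Equiv.swap a i) h
      simpa using this)
    simp [Equiv.swap_apply_of_ne_of_ne h1 hij]
  · simp

variable {α : Type*} [Fintype α] [DecidableEq α]

/-- A symmetric differentiable function that vanishes on the diagonal `lam i = lam j` vanishes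
there to second order. -/
lemma derivative_eval_eq_zero_of_symmetric (H : (α → ℝ) → ℝ) (hd : Differentiable ℝ H)
    (hsymm : ∀ (σ : Equiv.Perm α) lam, H (lam ∘ σ) = H lam) {i j : α} (hij : i ≠ j)
    (hdiag : ∀ lam, lam i = lam j → H lam = 0) (lam : α → ℝ) (q : ℝ[X])
    (hq : ∀ t, H (Function.update lam i t) = q.eval t) : q.derivative.eval (lam j) = 0 := by
  set p : α → ℝ := Function.update lam i (lam j) with hp
  have hpij : p i = p j := by simp [hp, hij.symm]
  have hder : ∀ v : α → ℝ, HasDerivAt (fun t : ℝ => H (p + t • v)) (fderiv ℝ H p v) 0 := by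
    intro v
    have h1 : HasDerivAt (fun t : ℝ => p + t • v) v 0 := by
      simpa using ((hasDerivAt_id (0 : ℝ)).smul_const v).const_add p
    have h2 : HasFDerivAt H (fderiv ℝ H p) (p + (0 : ℝ) • v) := by
      simpa using (hd p).hasFDerivAt
    exact h2.comp_hasDerivAt 0 h1
  have hi : fderiv ℝ H p (Pi.single i 1) = q.derivative.eval (lam j) := by
    refine (hder _).unique ?_
    have h1 : (fun t : ℝ => H (p + t • Pi.single i (1 : ℝ))) = fun t => q.eval (lam j + t) := by
      funext t
      rw [← hq]
      congr 1
      funext k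
      by_cases hk : k = i
      · subst hk; simp [hp]
      · simp [hp, hk]
    rw [h1]
    have h2 := (q.hasDerivAt (lam j + 0)).comp_const_add (lam j) 0
    simpa using h2
  have hj : fderiv ℝ H p (Pi.single j 1) = fderiv ℝ H p (Pi.single i 1) := by
    refine (hder _).unique ?_
    have h1 : (fun t : ℝ => H (p + t • Pi.single j (1 : ℝ))) =
        fun t => H (p + t • Pi.single i (1 : ℝ)) := by
      funext t
      rw [← hsymm (Equiv.swap i j)]
      congr 1
      funext k
      simp only [Function.comp_apply, Pi.add_apply, Pi.smul_apply, smul_eq_mul]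
      by_cases hki : k = i
      · subst hki; simp [hpij]
      · by_cases hkj : k = j
        · subst hkj; simp [hpij, hij]
        · simp [Equiv.swap_apply_of_ne_of_ne hki hkj, hki, hkj]
    rw [h1]
    exact hder _
  -- The direction e_i + e_j stays inside the diagonal, where H is zero. As the derivatives along
  -- e_i and e_j agree by symmetry, both vanish.
  have hs : fderiv ℝ H p (Pi.single i 1 + Pi.single j 1) = 0 := by
    refine (hder _).unique ?_
    have h1 : (fun t : ℝ => H (p + t • (Pi.single i (1 : ℝ) + Pi.single j 1))) = fun _ => 0 := by
      funext t
      apply hdiag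
      simp [hpij, hij, hij.symm]
    rw [h1]
    exact hasDerivAt_const _ _
  rw [map_add, hj, hi] at hs
  linarith

/-- A symmetric polynomial function vanishing on the diagonals whose degree in each variable is
less than twice the number of the other variables is zero. -/
theorem eq_zero_of_symmetric_of_degree_lt (H : (α → ℝ) → ℝ) (hd : Differentiable ℝ H)
    (hsymm : ∀ (σ : Equiv.Perm α) lam, H (lam ∘ σ) = H lam) {a b : α} (hab : a ≠ b)
    (hdiag : ∀ lam, lam a = lam b → H lam = 0) {d : ℕ} (hdeg : d < 2 * (Fintype.card α - 1))
    (hq : ∀ lam : α → ℝ, ∃ q : ℝ[X], q.natDegree ≤ d ∧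
      ∀ t, H (Function.update lam a t) = q.eval t) (lam : α → ℝ) : H lam = 0 := by
  have hdiag' : ∀ i j, i ≠ j → ∀ lam, lam i = lam j → H lam = 0 := by
    intro i j hij lam h
    obtain ⟨σ, rfl, rfl⟩ := exists_perm_apply_eq hab hij
    rw [← hsymm σ]
    exact hdiag _ h
  by_cases hinj : Function.Injective lam
  swap
  · simp only [Function.Injective, not_forall] at hinj
    obtain ⟨i, j, h, hne⟩ := hinj
    exact hdiag' i j hne lam h
  obtain ⟨q, hqd, hqe⟩ := hq lam
  suffices hq0 : q = 0 by
    have := hqe (lam a)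
    rwa [Function.update_eq_self, hq0, eval_zero] at this
  by_contra hq0
  -- At an injective point the other coordinates are distinct double roots of q, so their squared
  -- factors are coprime and together exceed the degree d.
  have hdvd : ∏ j ∈ Finset.univ.erase a, (X - C (lam j)) ^ 2 ∣ q := by
    refine Finset.prod_dvd_of_coprime ?_ ?_
    · intro i _ j _ hij
      exact (isCoprime_X_sub_C_of_isUnit_sub
        (sub_ne_zero.2 (hinj.ne hij)).isUnit).pow
    · intro j hj
      have hja : a ≠ j := (Finset.ne_of_mem_erase hj).symm
      rw [← le_rootMultiplicity_iff hq0]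
      refine Nat.succ_le_of_lt ((one_lt_rootMultiplicity_iff_isRoot hq0).2 ⟨?_, ?_⟩)
      · rw [IsRoot, ← hqe]
        exact hdiag' a j hja _ (by simp [hja.symm])
      · exact derivative_eval_eq_zero_of_symmetric H hd hsymm hja (hdiag' a j hja) lam q hqe
  have h1 := natDegree_le_of_dvd hdvd hq0
  rw [natDegree_prod_of_monic _ _ fun j _ => (monic_X_sub_C _).pow 2] at h1
  simp only [natDegree_pow, natDegree_X_sub_C, mul_one, Finset.sum_const, smul_eq_mul,
    Finset.card_erase_of_mem (Finset.mem_univ a), Finset.card_univ] at h1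
  omega

end Symmetric

/-! ### Universality of the fourth moment for r = 2. -/

section Quartic

variable {𝕜 : Type} [RCLike 𝕜] {n : ℕ} {W : Type} [Fintype W]

/-- The `p`-th moment of the block determinant for independent columns with the discrete law that
gives weight `w a` to `x a`. -/
def discreteMoment {r : ℕ} (p : ℕ) (w : W → ℝ) (x : W → Fin r → 𝕜) (lam : Fin n × Fin r → ℝ) : ℝ :=
  ∑ f : Fin n × Fin r → W,
    (∏ i, w (f i)) * ‖blockDet (fun i => (lam i : 𝕜)) (fun i => x (f i))‖ ^ p

/-- The fourth moment of the determinant of two independent columns. -/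
def pairMoment (w : W → ℝ) (x : W → Fin 2 → 𝕜) : ℝ :=
  ∑ a, ∑ b, w a * w b * ‖x a 0 * x b 1 - x a 1 * x b 0‖ ^ 4

lemma discreteMoment_comp_perm {r p : ℕ} (w : W → ℝ) (x : W → Fin r → 𝕜)
    (σ : Equiv.Perm (Fin n × Fin r)) (lam : Fin n × Fin r → ℝ) :
    discreteMoment p w x (lam ∘ σ) = discreteMoment p w x lam := by
  rw [discreteMoment, discreteMoment,
    ← (Equiv.arrowCongr σ.symm (Equiv.refl W)).sum_comp]
  refine Finset.sum_congr rfl fun f _ => ?_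
  congr 1
  · exact Equiv.prod_comp σ fun i => w (f i)
  · rw [← norm_blockDet_comp_perm (fun i => (lam i : 𝕜)) _ σ]
    rfl

lemma discreteMoment_zero {r p : ℕ} (w : W → ℝ) (x : W → Fin r → 𝕜) (lam : Fin 0 × Fin r → ℝ) :
    discreteMoment p w x lam = 1 := by
  have : IsEmpty (Fin 0 × Fin r) := inferInstance
  simp [discreteMoment, blockDet]

/-- By `blockDet_of_eq_on_first` the two vectors of the first block enter only through their 2 × 2
determinant, so the sum over them separates. -/
lemma discreteMoment_succ_of_eq (w : W → ℝ) (x : W → Fin 2 → 𝕜)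
    (lam : Fin (n + 1) × Fin 2 → ℝ) (h : lam (0, 0) = lam (0, 1)) :
    discreteMoment 4 w x lam = pairMoment w x *
      ((∏ i : Fin n × Fin 2, (lam (i.1.succ, i.2) - lam (0, 0)) ^ 4) *
        discreteMoment 4 w x fun i => lam (i.1.succ, i.2)) := by
  have hl : ∀ l, ((lam (0, l) : ℝ) : 𝕜) = (lam (0, 0) : 𝕜) := by
    intro l
    fin_cases l
    · rfl
    · simp [h]
  rw [discreteMoment, ← (Equiv.arrowCongr (blockSplit n 2) (Equiv.refl W)).sum_comp,
    ← (Equiv.sumArrowEquivProdArrow _ _ _).symm.sum_comp, Fintype.sum_prod_type,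
    ← (finTwoArrowEquiv W).symm.sum_comp, Fintype.sum_prod_type, pairMoment, discreteMoment]
  simp_rw [Finset.sum_mul, Finset.mul_sum]
  refine Finset.sum_congr rfl fun a _ => Finset.sum_congr rfl fun b _ =>
    Finset.sum_congr rfl fun f _ => ?_
  rw [blockDet_of_eq_on_first _ _ _ hl, ← (blockSplit n 2).prod_comp, Fintype.prod_sum_type]
  have e1 : ∀ i, (Equiv.arrowCongr (blockSplit n 2) (Equiv.refl W))
      ((Equiv.sumArrowEquivProdArrow (Fin 2) (Fin n × Fin 2) W).symm
        ((finTwoArrowEquiv W).symm (a, b), f)) ((blockSplit n 2) i) =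
      Sum.elim ![a, b] f i := by
    intro i
    simp only [Equiv.arrowCongr_apply, Function.comp_apply, Equiv.symm_apply_apply]
    rcases i with i | i <;> rfl
  have e2 : ∀ l, (Equiv.arrowCongr (blockSplit n 2) (Equiv.refl W))
      ((Equiv.sumArrowEquivProdArrow (Fin 2) (Fin n × Fin 2) W).symm
        ((finTwoArrowEquiv W).symm (a, b), f)) (0, l) = ![a, b] l := fun l => e1 (Sum.inl l)
  have e3 : ∀ i : Fin n × Fin 2, (Equiv.arrowCongr (blockSplit n 2) (Equiv.refl W))
      ((Equiv.sumArrowEquivProdArrow (Fin 2) (Fin n × Fin 2) W).symm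
        ((finTwoArrowEquiv W).symm (a, b), f)) (i.1.succ, i.2) = f i := fun i => e1 (Sum.inr i)
  simp only [e1, e2, e3, Sum.elim_inl, Sum.elim_inr, Matrix.det_fin_two, Matrix.of_apply,
    Fin.prod_univ_two, norm_mul, norm_prod, mul_pow, Matrix.cons_val_zero, Matrix.cons_val_one,
    ← Finset.prod_pow]
  have e4 : ∏ i : Fin n × Fin 2, ‖((lam (i.1.succ, i.2) : ℝ) : 𝕜) - (lam (0, 0) : 𝕜)‖ ^ 4 =
      ∏ i : Fin n × Fin 2, (lam (i.1.succ, i.2) - lam (0, 0)) ^ 4 := by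
    refine Finset.prod_congr rfl fun i _ => ?_
    rw [← RCLike.ofReal_sub, RCLike.norm_ofReal]
    exact (show Even 4 by decide).pow_abs _
  rw [e4]
  ring

lemma norm_pow_four_eq (z : 𝕜) : ‖z‖ ^ 4 = (RCLike.re z ^ 2 + RCLike.im z ^ 2) ^ 2 := by
  have h := (RCLike.normSq_eq_def' z).symm.trans (RCLike.normSq_apply z)
  rw [show ‖z‖ ^ 4 = (‖z‖ ^ 2) ^ 2 by ring, h]
  ring

lemma differentiable_norm_blockDet_pow_four {r : ℕ} (x : Fin n × Fin r → Fin r → 𝕜) :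
    Differentiable ℝ fun lam : Fin n × Fin r → ℝ => ‖blockDet (fun i => (lam i : 𝕜)) x‖ ^ 4 := by
  have h1 : ∀ i : Fin n × Fin r, Differentiable ℝ fun lam : Fin n × Fin r → ℝ => (lam i : 𝕜) :=
    fun i => (RCLike.ofRealCLM (K := 𝕜)).differentiable.comp (differentiable_apply i)
  have h2 : Differentiable ℝ fun lam : Fin n × Fin r → ℝ => blockDet (fun i => (lam i : 𝕜)) x := by
    simp_rw [blockDet_eq_sum]
    fun_prop
  have h3 : (fun lam : Fin n × Fin r → ℝ => ‖blockDet (fun i => (lam i : 𝕜)) x‖ ^ 4) =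
      fun lam => (RCLike.re (blockDet (fun i => (lam i : 𝕜)) x) ^ 2 +
        RCLike.im (blockDet (fun i => (lam i : 𝕜)) x) ^ 2) ^ 2 := by
    funext lam
    exact norm_pow_four_eq _
  rw [h3]
  have h4 := (RCLike.reCLM (K := 𝕜)).differentiable.comp h2
  have h5 := (RCLike.imCLM (K := 𝕜)).differentiable.comp h2
  exact ((h4.pow 2).add (h5.pow 2)).pow 2

/-- Each term of the permutation expansion contains `lam i` to a power at most n, and real and
imaginary parts enter the fourth power of the norm with total degree 4. -/
lemma exists_polynomial_norm_blockDet_pow_four {r : ℕ} (x : Fin (n + 1) × Fin r → Fin r → 𝕜)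
    (lam : Fin (n + 1) × Fin r → ℝ) (i : Fin (n + 1) × Fin r) :
    ∃ q : ℝ[X], q.natDegree ≤ 4 * n ∧ ∀ t : ℝ,
      ‖blockDet (fun j => ((Function.update lam i t j : ℝ) : 𝕜)) x‖ ^ 4 = q.eval t := by
  let c : Equiv.Perm (Fin (n + 1) × Fin r) → 𝕜 := fun σ =>
    ((Equiv.Perm.sign σ : ℤ) : 𝕜) * (∏ j ∈ Finset.univ.erase i, (lam j : 𝕜) ^ ((σ j).1 : ℕ)) *
      ∏ j, x j (σ j).2
  have hc : ∀ t : ℝ, blockDet (fun j => ((Function.update lam i t j : ℝ) : 𝕜)) x =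
      ∑ σ, c σ * ((t ^ ((σ i).1 : ℕ) : ℝ) : 𝕜) := by
    intro t
    rw [blockDet_eq_sum]
    refine Finset.sum_congr rfl fun σ _ => ?_
    rw [← Finset.mul_prod_erase _ _ (Finset.mem_univ i)]
    have : ∏ j ∈ Finset.univ.erase i, ((Function.update lam i t j : ℝ) : 𝕜) ^ ((σ j).1 : ℕ) =
        ∏ j ∈ Finset.univ.erase i, (lam j : 𝕜) ^ ((σ j).1 : ℕ) :=
      Finset.prod_congr rfl fun j hj => by
        rw [Function.update_of_ne (Finset.ne_of_mem_erase hj)]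
    rw [this]
    simp only [c, Function.update_self, RCLike.ofReal_pow]
    ring
  let P : (𝕜 → ℝ) → ℝ[X] := fun φ => ∑ σ, C (φ (c σ)) * X ^ ((σ i).1 : ℕ)
  have hP : ∀ φ, (P φ).natDegree ≤ n := fun φ =>
    natDegree_sum_le_of_forall_le _ _ fun σ _ =>
      (natDegree_C_mul_X_pow_le _ _).trans (Nat.lt_succ_iff.1 (σ i).1.isLt)
  refine ⟨(P RCLike.re ^ 2 + P RCLike.im ^ 2) ^ 2, ?_, fun t => ?_⟩
  · have h1 : (P RCLike.re ^ 2 + P RCLike.im ^ 2).natDegree ≤ 2 * n :=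
      natDegree_add_le_of_degree_le (natDegree_pow_le_of_le 2 (hP _))
        (natDegree_pow_le_of_le 2 (hP _))
    exact (natDegree_pow_le_of_le 2 h1).trans (by omega)
  · have hre : RCLike.re (blockDet (fun j => ((Function.update lam i t j : ℝ) : 𝕜)) x) =
        (P RCLike.re).eval t := by
      rw [hc, map_sum, eval_finsetSum]
      exact Finset.sum_congr rfl fun σ _ => by rw [RCLike.re_mul_ofReal]; simp
    have him : RCLike.im (blockDet (fun j => ((Function.update lam i t j : ℝ) : 𝕜)) x) =
        (P RCLike.im).eval t := by
      rw [hc, map_sum, eval_finsetSum]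
      exact Finset.sum_congr rfl fun σ _ => by rw [RCLike.im_mul_ofReal]; simp
    rw [eval_pow, eval_add, eval_pow, eval_pow, ← hre, ← him]
    exact norm_pow_four_eq _

lemma differentiable_discreteMoment_four {r : ℕ} (w : W → ℝ) (x : W → Fin r → 𝕜) :
    Differentiable ℝ fun lam : Fin n × Fin r → ℝ => discreteMoment 4 w x lam := by
  unfold discreteMoment
  exact Differentiable.fun_sum fun f _ =>
    (differentiable_norm_blockDet_pow_four fun i => x (f i)).const_mul _

lemma exists_polynomial_discreteMoment_four {r : ℕ} (w : W → ℝ) (x : W → Fin r → 𝕜)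
    (lam : Fin (n + 1) × Fin r → ℝ) (i : Fin (n + 1) × Fin r) :
    ∃ q : ℝ[X], q.natDegree ≤ 4 * n ∧ ∀ t : ℝ,
      discreteMoment 4 w x (Function.update lam i t) = q.eval t := by
  choose q hq hqe using fun f : Fin (n + 1) × Fin r → W =>
    exists_polynomial_norm_blockDet_pow_four (fun i => x (f i)) lam i
  refine ⟨∑ f, C (∏ i, w (f i)) * q f, ?_, fun t => ?_⟩
  · exact natDegree_sum_le_of_forall_le _ _ fun f _ => (natDegree_C_mul_le _ _).trans (hq f)
  · rw [discreteMoment, eval_finsetSum]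
    exact Finset.sum_congr rfl fun f _ => by rw [hqe, eval_mul, eval_C]

/-- Up to the constant `pairMoment ^ n`, the fourth moment of the block determinant does not depend
on the law of the columns. -/
theorem discreteMoment_four_universal {W' : Type} [Fintype W'] (w : W → ℝ) (x : W → Fin 2 → 𝕜)
    (w' : W' → ℝ) (x' : W' → Fin 2 → 𝕜) :
    ∀ (n : ℕ) (lam : Fin n × Fin 2 → ℝ),
      pairMoment w' x' ^ n * discreteMoment 4 w x lam =
        pairMoment w x ^ n * discreteMoment 4 w' x' lam := by
  intro n
  induction n with
  | zero => intro lam; rw [discreteMoment_zero, discreteMoment_zero]; simp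
  | succ n ih =>
    intro lam
    -- The cross-multiplied form needs no division by a `pairMoment`, which may vanish.
    rw [← sub_eq_zero]
    refine eq_zero_of_symmetric_of_degree_lt (a := (0, 0)) (b := (0, 1)) (d := 4 * n)
      (fun lam => pairMoment w' x' ^ (n + 1) * discreteMoment 4 w x lam -
        pairMoment w x ^ (n + 1) * discreteMoment 4 w' x' lam) ?_ ?_ (by simp) ?_ ?_ ?_ lam
    · exact ((differentiable_discreteMoment_four w x).const_mul _).sub
        ((differentiable_discreteMoment_four w' x').const_mul _)
    · intro σ lam
      simp only [discreteMoment_comp_perm]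
    -- On the diagonal each moment yields one `pairMoment` and the same product of fourth powers,
    -- leaving the induction hypothesis.
    · intro lam h
      simp only [discreteMoment_succ_of_eq _ _ lam h]
      have := ih fun i => lam (i.1.succ, i.2)
      linear_combination (pairMoment w x * pairMoment w' x' *
        ∏ i : Fin n × Fin 2, (lam (i.1.succ, i.2) - lam (0, 0)) ^ 4) * this
    -- The degree count is 4n < 2 (2 (n + 1) - 1) = 4n + 2.
    · simp only [Fintype.card_prod, Fintype.card_fin]
      omega
    · intro lam
      obtain ⟨q, hq, hqe⟩ := exists_polynomial_discreteMoment_four w x lam (0, 0)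
      obtain ⟨q', hq', hqe'⟩ := exists_polynomial_discreteMoment_four w' x' lam (0, 0)
      refine ⟨C (pairMoment w' x' ^ (n + 1)) * q - C (pairMoment w x ^ (n + 1)) * q', ?_, ?_⟩
      · exact (natDegree_sub_le_of_le ((natDegree_C_mul_le _ _).trans hq)
          ((natDegree_C_mul_le _ _).trans hq')).trans (by simp)
      · intro t
        rw [eval_sub, eval_mul, eval_mul, eval_C, eval_C, hqe, hqe']

end Quartic

end BlockMoment

namespace BlockMoment
open Matrix
open scoped ComplexConjugate

/-! ### Replacing a column law by a discrete one. -/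

section MomentMatching

variable {𝕜 : Type} [RCLike 𝕜] {n r : ℕ}

/-- The coefficient of a monomial in `|blockDet| ^ (2 * k)`. -/
def blockCoeff (k : ℕ) (lam : Fin n × Fin r → 𝕜)
    (s t : Fin k → Equiv.Perm (Fin n × Fin r)) : 𝕜 :=
  (∏ l, ((Equiv.Perm.sign (s l) : ℤ) : 𝕜) * ∏ i, lam i ^ ((s l i).1 : ℕ)) *
    ∏ l, conj (((Equiv.Perm.sign (t l) : ℤ) : 𝕜) * ∏ i, lam i ^ ((t l i).1 : ℕ))

lemma norm_blockDet_pow_eq_sum (k : ℕ) (lam : Fin n × Fin r → 𝕜)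
    (x : Fin n × Fin r → Fin r → 𝕜) :
    ((‖blockDet lam x‖ ^ (2 * k) : ℝ) : 𝕜) =
      ∑ s : Fin k → Equiv.Perm (Fin n × Fin r), ∑ t : Fin k → Equiv.Perm (Fin n × Fin r),
        blockCoeff k lam s t *
          ∏ i, ((∏ l, x i (s l i).2) * ∏ l, conj (x i (t l i).2)) := by
  have h1 : ((‖blockDet lam x‖ ^ (2 * k) : ℝ) : 𝕜) =
      (blockDet lam x) ^ k * conj (blockDet lam x) ^ k := by
    rw [pow_mul, ← mul_pow, RCLike.mul_conj]
    push_cast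
    rfl
  rw [h1, blockDet_eq_sum, map_sum]
  have h2 : ∀ a : Equiv.Perm (Fin n × Fin r) → 𝕜,
      (∑ σ, a σ) ^ k = ∑ s : Fin k → Equiv.Perm (Fin n × Fin r), ∏ l, a (s l) := by
    intro a
    rw [← Fintype.piFinset_univ, ← Finset.prod_univ_sum]
    simp
  rw [h2, h2, Finset.sum_mul_sum]
  refine Finset.sum_congr rfl fun s _ => Finset.sum_congr rfl fun t _ => ?_
  simp only [blockCoeff, map_mul, Finset.prod_mul_distrib, map_prod]
  rw [Finset.prod_comm (f := fun i l => x i (s l i).2),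
    Finset.prod_comm (f := fun i l => conj (x i (t l i).2))]
  ring

/-- The mixed moments `∫ z ^ p * conj z ^ q` of a measure. -/
noncomputable def mixedMoment [MeasurableSpace 𝕜] (γ : Measure 𝕜) (p q : ℕ) : 𝕜 :=
  ∫ z, z ^ p * conj z ^ q ∂γ

lemma prod_eval_eq_prod_pow {k : ℕ} (y : Fin r → 𝕜) (u : Fin k → Fin r) :
    ∏ l, y (u l) = ∏ a, y a ^ (Finset.univ.filter fun l => u l = a).card := by
  rw [← Finset.prod_fiberwise (s := Finset.univ) (g := u)]
  refine Finset.prod_congr rfl fun a _ => ?_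
  rw [← Finset.prod_const]
  exact Finset.prod_congr rfl fun l hl => by rw [(Finset.mem_filter.1 hl).2]

variable [MeasurableSpace 𝕜]

/-- The law of an `r × N` matrix with independent entries of law `γ`. -/
noncomputable abbrev matrixLaw (r N : ℕ) (γ : Measure 𝕜) : Measure (Fin r → Fin N → 𝕜) :=
  Measure.pi fun _ => Measure.pi fun _ => γ

lemma integrable_monomial {N : ℕ} (γ : Measure 𝕜) [IsProbabilityMeasure γ]
    (hγ : ∀ p q : ℕ, Integrable (fun z : 𝕜 => z ^ p * conj z ^ q) γ)
    (p q : Fin r → Fin N → ℕ) :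
    Integrable (fun X : Fin r → Fin N → 𝕜 => ∏ a, ∏ i, (X a i ^ p a i * conj (X a i) ^ q a i))
      (matrixLaw r N γ) := by
  refine Integrable.fintype_prod
    (f := fun a (x : Fin N → 𝕜) => ∏ i, (x i ^ p a i * conj (x i) ^ q a i)) fun a => ?_
  exact Integrable.fintype_prod
    (f := fun i (z : 𝕜) => (z ^ p a i * conj z ^ q a i)) fun i => hγ _ _

lemma integral_monomial {N : ℕ} (γ : Measure 𝕜) [IsProbabilityMeasure γ]
    (p q : Fin r → Fin N → ℕ) :
    ∫ X : Fin r → Fin N → 𝕜, ∏ a, ∏ i, (X a i ^ p a i * conj (X a i) ^ q a i)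
      ∂(matrixLaw r N γ) = ∏ a, ∏ i, mixedMoment γ (p a i) (q a i) := by
  rw [integral_fintype_prod_eq_prod
    (f := fun a (x : Fin N → 𝕜) => ∏ i, (x i ^ p a i * conj (x i) ^ q a i))]
  refine Finset.prod_congr rfl fun a _ => ?_
  rw [integral_fintype_prod_eq_prod (f := fun i (z : 𝕜) => (z ^ p a i * conj z ^ q a i))]
  rfl

/-- The law `γ` and the discrete law `(w, x)` of a column have the same moments of bidegree
`(k, k)`. -/
def MomentsMatch {W : Type} [Fintype W] (k : ℕ) (γ : Measure 𝕜) (w : W → ℝ)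
    (x : W → Fin r → 𝕜) : Prop :=
  ∀ u v : Fin k → Fin r, ∑ a, (w a : 𝕜) * ((∏ l, x a (u l)) * ∏ l, conj (x a (v l))) =
    ∏ b, mixedMoment γ (Finset.univ.filter fun l => u l = b).card
      (Finset.univ.filter fun l => v l = b).card

/-- In the expansion over k permutations and k conjugate ones, every monomial is a product over
columns of factors of bidegree (k, k). Independence integrates these separately, so only the matched
moments are used. -/
theorem integral_norm_blockDet_pow {W : Type} [Fintype W] {N k : ℕ} (γ : Measure 𝕜)
    [IsProbabilityMeasure γ] (hγ : ∀ p q : ℕ, Integrable (fun z : 𝕜 => z ^ p * conj z ^ q) γ)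
    (w : W → ℝ) (x : W → Fin r → 𝕜) (h : MomentsMatch k γ w x) (e : Fin n × Fin r ≃ Fin N)
    (lam : Fin n × Fin r → ℝ) :
    Integrable (fun X : Fin r → Fin N → 𝕜 =>
      ‖blockDet (fun i => (lam i : 𝕜)) (fun i a => X a (e i))‖ ^ (2 * k)) (matrixLaw r N γ) ∧
    ∫ X : Fin r → Fin N → 𝕜,
      ‖blockDet (fun i => (lam i : 𝕜)) (fun i a => X a (e i))‖ ^ (2 * k) ∂(matrixLaw r N γ) =
      discreteMoment (2 * k) w x lam := by
  have hmon : ∀ (s t : Fin k → Equiv.Perm (Fin n × Fin r)) (X : Fin r → Fin N → 𝕜),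
      ∏ i, ((∏ l, X (s l i).2 (e i)) * ∏ l, conj (X (t l i).2 (e i))) =
      ∏ a, ∏ j, (X a j ^ (Finset.univ.filter fun l => (s l (e.symm j)).2 = a).card *
        conj (X a j) ^ (Finset.univ.filter fun l => (t l (e.symm j)).2 = a).card) := by
    intro s t X
    rw [Finset.prod_comm, ← e.prod_comp]
    refine Finset.prod_congr rfl fun i _ => ?_
    rw [prod_eval_eq_prod_pow (fun a => X a (e i)) fun l => (s l i).2,
      prod_eval_eq_prod_pow (fun a => conj (X a (e i))) fun l => (t l i).2,
      ← Finset.prod_mul_distrib]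
    simp
  have hint : ∀ s t : Fin k → Equiv.Perm (Fin n × Fin r),
      Integrable (fun X : Fin r → Fin N → 𝕜 => blockCoeff k (fun i => (lam i : 𝕜)) s t *
        ∏ i, ((∏ l, X (s l i).2 (e i)) * ∏ l, conj (X (t l i).2 (e i)))) (matrixLaw r N γ) := by
    intro s t
    simp_rw [hmon]
    exact (integrable_monomial γ hγ _ _).const_mul _
  have hI : Integrable (fun X : Fin r → Fin N → 𝕜 =>
      ((‖blockDet (fun i => (lam i : 𝕜)) (fun i a => X a (e i))‖ ^ (2 * k) : ℝ) : 𝕜))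
      (matrixLaw r N γ) := by
    simp_rw [norm_blockDet_pow_eq_sum]
    exact integrable_finsetSum _ fun s _ => integrable_finsetSum _ fun t _ => hint s t
  refine ⟨by simpa using hI.re, ?_⟩
  apply RCLike.ofReal_injective (K := 𝕜)
  rw [← integral_ofReal]
  simp_rw [norm_blockDet_pow_eq_sum]
  rw [integral_finsetSum _ fun s _ => integrable_finsetSum _ fun t _ => hint s t]
  simp_rw [discreteMoment, RCLike.ofReal_sum, RCLike.ofReal_mul, norm_blockDet_pow_eq_sum]
  simp_rw [Finset.mul_sum]
  rw [Finset.sum_comm]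
  refine Finset.sum_congr rfl fun s _ => ?_
  rw [Finset.sum_comm, integral_finsetSum _ fun t _ => hint s t]
  refine Finset.sum_congr rfl fun t _ => ?_
  rw [integral_const_mul]
  simp_rw [hmon]
  rw [integral_monomial]
  simp_rw [mul_left_comm _ (blockCoeff _ _ _ _)]
  rw [← Finset.mul_sum]
  congr 1
  rw [Finset.prod_comm, ← e.prod_comp]
  simp_rw [Equiv.symm_apply_apply, RCLike.ofReal_prod, ← Finset.prod_mul_distrib]
  -- The sum over all assignments of a product over columns is the product of the single-column
  -- sums.
  rw [← Fintype.piFinset_univ, ← Finset.prod_univ_sum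
    (f := fun i a => (w a : 𝕜) * ∏ l, x a (s l i).2 * conj (x a (t l i).2))]
  refine Finset.prod_congr rfl fun i _ => ?_
  rw [← h (fun l => (s l i).2) (fun l => (t l i).2)]
  simp_rw [Finset.prod_mul_distrib]

end MomentMatching

end BlockMoment

namespace BlockMoment
open ProbabilityTheory
open scoped ENNReal

/-! ### Rising factorials. -/

section Rising

/-- The rising factorial `a (a + 1) ⋯ (a + K - 1)`. -/
noncomputable def rising (a : ℝ) (K : ℕ) : ℝ := ∏ i ∈ Finset.range K, (a + i)

lemma rising_zero (a : ℝ) : rising a 0 = 1 := by simp [rising]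

lemma rising_succ (a : ℝ) (K : ℕ) : rising a (K + 1) = rising a K * (a + K) := by
  rw [rising, Finset.prod_range_succ, rising]

lemma rising_nonneg {a : ℝ} (ha : 0 ≤ a) (K : ℕ) : 0 ≤ rising a K :=
  Finset.prod_nonneg fun i _ => by positivity

lemma rising_pos {a : ℝ} (ha : 0 < a) (K : ℕ) : 0 < rising a K :=
  Finset.prod_pos fun i _ => by positivity

lemma Gamma_add_natCast {a : ℝ} (ha : 0 < a) (K : ℕ) :
    Real.Gamma (a + K) = rising a K * Real.Gamma a := by
  induction K with
  | zero => simp [rising_zero]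
  | succ K ih =>
    rw [rising_succ, Nat.cast_succ, ← add_assoc, Real.Gamma_add_one (by positivity), ih]
    ring

/-- The binomial theorem for rising factorials. -/
lemma sum_choose_mul_rising (a b : ℝ) (K : ℕ) :
    ∑ p ∈ Finset.HasAntidiagonal.antidiagonal K, (K.choose p.1 : ℝ) * 
        (rising a p.1 * rising b p.2) =
      rising (a + b) K := by
  induction K with
  | zero => simp [rising_zero]
  | succ K ih =>
    rw [Finset.sum_antidiagonal_choose_succ_mul (fun i j => rising a i * rising b j),
      rising_succ, ← ih, Finset.sum_mul, ← Finset.sum_add_distrib]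
    refine Finset.sum_congr rfl fun p hp => ?_
    rw [rising_succ, rising_succ, ← Finset.HasAntidiagonal.mem_antidiagonal.1 hp]
    have : ((p.1 + p.2).choose p.2 : ℝ) = (p.1 + p.2).choose p.1 := by
      rw [Nat.choose_symm_add]
    push_cast
    rw [this]
    ring

end Rising

/-! ### Moments of χ² type. -/

section SumOfSquares

variable {Ω : Type*} [MeasurableSpace Ω] {μ : Measure Ω} [IsProbabilityMeasure μ]

/-- The moments of a sum of independent variables with the moments of a `χ²` variable with
`2 * a` degrees of freedom. -/
theorem lintegral_sum_pow_of_indep {ι : Type*} {f : ι → Ω → ℝ≥0∞} (hf : ∀ i, Measurable (f i))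
    (hind : iIndepFun f μ) {a : ℝ} (ha : 0 ≤ a)
    (hmom : ∀ i K, ∫⁻ ω, f i ω ^ K ∂μ = ENNReal.ofReal (2 ^ K * rising a K)) (J : Finset ι) :
    ∀ K : ℕ, ∫⁻ ω, (∑ i ∈ J, f i ω) ^ K ∂μ = ENNReal.ofReal (2 ^ K * rising (J.card * a) K) := by
  classical
  induction J using Finset.induction_on with
  | empty =>
    intro K
    cases K with
    | zero => simp [rising_zero]
    | succ K => simp [rising, Finset.prod_range_succ']
  | insert i J hi ih =>
    intro K
    have hJm : Measurable fun ω => ∑ j ∈ J, f j ω := Finset.measurable_sum _ fun j _ => hf j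
    have hindep : IndepFun (fun ω => ∑ j ∈ J, f j ω) (f i) μ := by
      have := hind.indepFun_finsetSum_of_notMem hf hi
      rwa [show (∑ j ∈ J, f j) = fun ω => ∑ j ∈ J, f j ω from by ext; simp] at this
    have hpow : ∀ ω, (∑ j ∈ insert i J, f j ω) ^ K =
        ∑ p ∈ Finset.HasAntidiagonal.antidiagonal K,
          K.choose p.1 • ((∑ j ∈ J, f j ω) ^ p.1 * f i ω ^ p.2) := fun ω => by
      rw [Finset.sum_insert hi, add_comm, (Commute.all _ _).add_pow']
    have hpm : ∀ p : ℕ × ℕ, Measurable fun ω => (∑ j ∈ J, f j ω) ^ p.1 * f i ω ^ p.2 := fun p =>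
      (hJm.pow_const _).mul ((hf i).pow_const _)
    simp_rw [hpow]
    rw [lintegral_finsetSum]
    swap
    · intro p _
      simp_rw [nsmul_eq_mul]
      exact (hpm p).const_mul _
    have hp : ∀ p ∈ Finset.HasAntidiagonal.antidiagonal K,
        ∫⁻ ω, K.choose p.1 • ((∑ j ∈ J, f j ω) ^ p.1 * f i ω ^ p.2) ∂μ =
        ENNReal.ofReal
          (2 ^ K * ((K.choose p.1 : ℝ) * (rising (J.card * a) p.1 * rising a p.2))) := by
      intro p hp
      simp_rw [nsmul_eq_mul]
      rw [lintegral_const_mul _ (hpm p),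
        lintegral_mul_eq_lintegral_mul_lintegral_of_indepFun'' (hJm.pow_const _).aemeasurable
          ((hf i).pow_const _).aemeasurable
          (hindep.comp (measurable_id.pow_const p.1) (measurable_id.pow_const p.2)),
        ih, hmom, ← ENNReal.ofReal_natCast, ← ENNReal.ofReal_mul, ← ENNReal.ofReal_mul]
      · congr 1
        rw [← Finset.HasAntidiagonal.mem_antidiagonal.1 hp, pow_add]
        ring
      · positivity
      · exact mul_nonneg (by positivity) (rising_nonneg (by positivity) _)
    rw [Finset.sum_congr rfl hp, ← ENNReal.ofReal_sum_of_nonneg]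
    · rw [← Finset.mul_sum, sum_choose_mul_rising, Finset.card_insert_of_notMem hi]
      push_cast
      ring_nf
    · intro p _
      have h1 : 0 ≤ rising (J.card * a) p.1 := rising_nonneg (by positivity) _
      have h2 : 0 ≤ rising a p.2 := rising_nonneg ha _
      positivity

lemma integral_pow_gaussianReal (K : ℕ) :
    ∫ x, x ^ (2 * K) ∂(gaussianReal 0 1) = 2 ^ K * rising (1 / 2) K := by
  have h0 : ∀ K : ℕ, ∫ x, x ^ (2 * K) ∂(gaussianReal 0 1) =
      (Real.sqrt (2 * Real.pi))⁻¹ * (2 * ((1 / 2 : ℝ) ^ (-(((2 * K : ℕ) : ℝ) + 1) / 2) * (1 / 2) *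
        Real.Gamma ((((2 * K : ℕ) : ℝ) + 1) / 2))) := by
    intro K
    rw [integral_gaussianReal_eq_integral_smul one_ne_zero,
      ← integral_rpow_mul_exp_neg_mul_rpow (by norm_num)
        (by linarith [Nat.cast_nonneg (α := ℝ) (2 * K)])
        (by norm_num), ← integral_comp_abs
        (f := fun x : ℝ => x ^ (((2 * K : ℕ) : ℝ)) * Real.exp (-(1 / 2) * x ^ (2 : ℝ))),
      ← integral_const_mul]
    congr 1
    funext x
    have h2 : |x| ^ (2 : ℝ) = x ^ 2 := by
      rw [← sq_abs, ← Real.rpow_natCast]; norm_num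
    rw [Real.rpow_natCast, h2, Even.pow_abs ⟨K, by ring⟩, gaussianPDFReal]
    simp only [NNReal.coe_one, mul_one, sub_zero, smul_eq_mul]
    rw [show -x ^ 2 / 2 = -(1 / 2) * x ^ 2 by ring]
    ring
  -- The case K = 0 expresses that the Gaussian has mass one and supplies the normalising constant.
  have h1 := h0 0
  simp only [mul_zero, pow_zero, integral_const, probReal_univ, smul_eq_mul, mul_one,
    Nat.cast_zero, zero_add] at h1
  have h2 : -(((2 * K : ℕ) : ℝ) + 1) / 2 = -1 / 2 + (-(K : ℕ) : ℝ) := by push_cast; ring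
  have h3 : (((2 * K : ℕ) : ℝ) + 1) / 2 = 1 / 2 + K := by push_cast; ring
  rw [h0, h2, h3, Gamma_add_natCast (by norm_num), Real.rpow_add (by norm_num),
    Real.rpow_neg (by norm_num) (K : ℝ), Real.rpow_natCast, one_div_pow, one_div (2 ^ K : ℝ), inv_inv]
  rw [one_div] at h1 ⊢
  linear_combination (-(2 ^ K * rising (2⁻¹) K)) * h1

end SumOfSquares
end BlockMoment

namespace BlockMoment
open ProbabilityTheory Matrix
open scoped ENNReal

/-! ### Standard Gaussian vectors. -/

section StdGaussian

lemma lintegral_enorm_pow_gaussianReal (K : ℕ) :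
    ∫⁻ x, (‖x‖ₑ ^ 2) ^ K ∂(gaussianReal 0 1) = ENNReal.ofReal (2 ^ K * rising (1 / 2) K) := by
  rw [← integral_pow_gaussianReal, ofReal_integral_eq_lintegral_ofReal]
  · refine lintegral_congr fun x => ?_
    rw [← pow_mul, ← ofReal_norm, ← ENNReal.ofReal_pow (norm_nonneg _), Real.norm_eq_abs,
      Even.pow_abs ⟨K, by ring⟩]
  · have h := (IsGaussian.memLp_id (gaussianReal 0 1) ((2 * K : ℕ) : ℝ≥0∞)
      (ENNReal.natCast_ne_top _)).integrable_norm_pow'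
    refine h.congr (ae_of_all _ fun x => ?_)
    simp [pow_mul]
  · exact ae_of_all _ fun x => (show Even (2 * K) from ⟨K, by ring⟩).pow_nonneg x

variable {E : Type*} [NormedAddCommGroup E] [InnerProductSpace ℝ E] [FiniteDimensional ℝ E]
  [MeasurableSpace E] [BorelSpace E]

lemma lintegral_enorm_pow_stdGaussian (K : ℕ) :
    ∫⁻ x, (‖x‖ₑ ^ 2) ^ K ∂(stdGaussian E) =
      ENNReal.ofReal (2 ^ K * rising (Module.finrank ℝ E / 2) K) := by
  rw [stdGaussian, lintegral_map (by fun_prop) (by fun_prop)]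
  have h1 : ∀ x : Fin (Module.finrank ℝ E) → ℝ,
      ‖∑ i, x i • stdOrthonormalBasis ℝ E i‖ₑ ^ 2 = ∑ i, ‖x i‖ₑ ^ 2 := by
    intro x
    have h2 := (stdOrthonormalBasis ℝ E).sum_sq_norm_inner_right
      (∑ i, x i • stdOrthonormalBasis ℝ E i)
    simp_rw [← ofReal_norm, ← ENNReal.ofReal_pow (norm_nonneg _)]
    rw [← ENNReal.ofReal_sum_of_nonneg fun _ _ => by positivity, ← h2]
    congr 1
    refine Finset.sum_congr rfl fun i _ => ?_
    rw [(stdOrthonormalBasis ℝ E).orthonormal.inner_right_fintype]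
  simp_rw [h1]
  have h3 := lintegral_sum_pow_of_indep
    (μ := Measure.pi fun _ : Fin (Module.finrank ℝ E) => gaussianReal 0 1)
    (f := fun i x => ‖x i‖ₑ ^ 2) (a := 1 / 2) (fun i => by fun_prop)
    (iIndepFun_pi (X := fun _ z => ‖z‖ₑ ^ 2) fun i => by fun_prop) (by norm_num)
    (fun i K => by
      rw [← lintegral_enorm_pow_gaussianReal,
        ← (measurePreserving_eval (fun _ : Fin (Module.finrank ℝ E) => gaussianReal 0 1)
          i).lintegral_comp (f := fun z => (‖z‖ₑ ^ 2) ^ K) (by fun_prop)]) Finset.univ K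
  rw [h3]
  simp [div_eq_mul_inv]

lemma lintegral_sum_enorm_pow_pi_stdGaussian {ι : Type*} [Fintype ι] (J : Finset ι) (K : ℕ) :
    ∫⁻ x, (∑ i ∈ J, ‖x i‖ₑ ^ 2) ^ K ∂(Measure.pi fun _ : ι => stdGaussian E) =
      ENNReal.ofReal (2 ^ K * rising (J.card * (Module.finrank ℝ E / 2)) K) :=
  lintegral_sum_pow_of_indep
    (μ := Measure.pi fun _ : ι => stdGaussian E)
    (f := fun i x => ‖x i‖ₑ ^ 2) (fun i => by fun_prop)
    (iIndepFun_pi (X := fun _ z => ‖z‖ₑ ^ 2) fun i => by fun_prop) (by positivity)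
    (fun i K => by
      rw [← lintegral_enorm_pow_stdGaussian,
        ← (measurePreserving_eval (fun _ : ι => stdGaussian E)
          i).lintegral_comp (f := fun z => (‖z‖ₑ ^ 2) ^ K) (by fun_prop)]) J K

/-- Both characteristic functions are `exp (-‖t‖² / 2)`, since squared norms add over the
coordinates. -/
lemma map_toLp_pi_stdGaussian {ι : Type*} [Fintype ι] :
    (Measure.pi fun _ : ι => stdGaussian E).map (WithLp.toLp 2) =
      stdGaussian (PiLp 2 fun _ : ι => E) := by
  apply Measure.ext_of_charFun (E := PiLp 2 fun _ : ι => E)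
  ext t
  rw [charFun_pi, charFun_stdGaussian]
  simp_rw [charFun_stdGaussian]
  rw [← Complex.exp_sum, ← Finset.sum_div, Finset.sum_neg_distrib]
  congr 3
  rw [← Complex.ofReal_pow, PiLp.norm_sq_eq_of_L2]
  push_cast
  rfl

end StdGaussian

/-! ### Unitary invariance of Gaussian rows. -/

section Matrices

instance instSecondCountableTopologyRCLike (𝕜 : Type) [RCLike 𝕜] : SecondCountableTopology 𝕜 := by
  have := FiniteDimensional.proper_rclike 𝕜 𝕜
  infer_instance

lemma sum_norm_sq_vecMul_unitary {𝕜 : Type} [RCLike 𝕜] {N : ℕ} (U : UGroup 𝕜 N) (x : Fin N → 𝕜) :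
    ∑ i, ‖(x ᵥ* (U : Matrix (Fin N) (Fin N) 𝕜)) i‖ ^ 2 = ∑ i, ‖x i‖ ^ 2 := by
  have h : ∀ y : Fin N → 𝕜, ((∑ i, ‖y i‖ ^ 2 : ℝ) : 𝕜) = y ⬝ᵥ star y := by
    intro y
    simp [dotProduct, RCLike.mul_conj]
  apply RCLike.ofReal_injective (K := 𝕜)
  rw [h, h, star_vecMul, dotProduct_mulVec, vecMul_vecMul, ← star_eq_conjTranspose,
    Unitary.mul_star_self_of_mem U.2, vecMul_one]

variable (𝕜 : Type) [RCLike 𝕜] [MeasurableSpace 𝕜] [BorelSpace 𝕜]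

/-- The standard Gaussian law on `𝕜` as a real Euclidean space. -/
noncomputable def scalarGaussian : Measure 𝕜 :=
  stdGaussian 𝕜

instance instIsProbabilityMeasureScalarGaussian : IsProbabilityMeasure (scalarGaussian 𝕜) := by
  unfold scalarGaussian
  infer_instance

variable {𝕜}

lemma lintegral_sum_enorm_pow_pi_scalarGaussian {ι : Type*} [Fintype ι] (J : Finset ι) (K : ℕ) :
    ∫⁻ x, (∑ i ∈ J, ‖x i‖ₑ ^ 2) ^ K ∂(Measure.pi fun _ : ι => scalarGaussian 𝕜) =
      ENNReal.ofReal (2 ^ K * rising (J.card * (Module.finrank ℝ 𝕜 / 2)) K) := by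
  exact lintegral_sum_enorm_pow_pi_stdGaussian (E := 𝕜) J K

/-- The law of a Gaussian row is invariant under unitary matrices. -/
theorem map_vecMul_pi_scalarGaussian {N : ℕ} (U : UGroup 𝕜 N) :
    MeasurePreserving (fun x : Fin N → 𝕜 => x ᵥ* (U : Matrix (Fin N) (Fin N) 𝕜))
      (Measure.pi fun _ => scalarGaussian 𝕜) (Measure.pi fun _ => scalarGaussian 𝕜) := by
  let L : (PiLp 2 fun _ : Fin N => 𝕜) ≃ₗᵢ[ℝ] (PiLp 2 fun _ : Fin N => 𝕜) :=
    { toFun := fun x => WithLp.toLp 2 (WithLp.ofLp x ᵥ* (U : Matrix (Fin N) (Fin N) 𝕜))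
      invFun := fun x => WithLp.toLp 2
        (WithLp.ofLp x ᵥ* ((U⁻¹ : UGroup 𝕜 N) : Matrix (Fin N) (Fin N) 𝕜))
      map_add' := fun x y => by simp [add_vecMul]
      map_smul' := fun c x => by
        ext i
        simp [vecMul, dotProduct, Finset.smul_sum]
      left_inv := fun x => by simp
      right_inv := fun x => by simp
      norm_map' := fun x => by
        rw [← sq_eq_sq₀ (norm_nonneg _) (norm_nonneg _), PiLp.norm_sq_eq_of_L2,
          PiLp.norm_sq_eq_of_L2]
        exact sum_norm_sq_vecMul_unitary U _ }
  have h1 := stdGaussian_map L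
  rw [← map_toLp_pi_stdGaussian, Measure.map_map L.continuous.measurable (by fun_prop)] at h1
  have hm : Measurable fun x : Fin N → 𝕜 => x ᵥ* (U : Matrix (Fin N) (Fin N) 𝕜) := by
    refine Continuous.measurable ?_
    fun_prop
  refine ⟨hm, ?_⟩
  apply (MeasurableEquiv.toLp 2 (Fin N → 𝕜)).map_measurableEquiv_injective
  rw [Measure.map_map (MeasurableEquiv.measurable _) hm]
  exact h1

end Matrices
end BlockMoment

namespace BlockMoment
open ProbabilityTheory Matrix
open scoped ENNReal

/-! ### Factoring through unitary rows; Gram determinants. -/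

section Decomposition

variable {𝕜 : Type} [RCLike 𝕜] {r N : ℕ}

/-- The first `r` rows of a matrix. -/
def topRows (h : r ≤ N) (V : Matrix (Fin N) (Fin N) 𝕜) : Matrix (Fin r) (Fin N) 𝕜 :=
  V.submatrix (Fin.castLE h) id

/-- Every `r × N` matrix is a square matrix times the first rows of a unitary matrix. -/
theorem exists_eq_mul_topRows (h : r ≤ N) (X : Matrix (Fin r) (Fin N) 𝕜) :
    ∃ (T : Matrix (Fin r) (Fin r) 𝕜) (V : UGroup 𝕜 N),
      X = T * topRows h (V : Matrix (Fin N) (Fin N) 𝕜) := by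
  -- Padding with zero vectors lets Gram–Schmidt return a full orthonormal basis, whatever the rank
  -- of X.
  let f : Fin N → EuclideanSpace 𝕜 (Fin N) := fun i =>
    if hi : (i : ℕ) < r then WithLp.toLp 2 (X ⟨i, hi⟩) else 0
  let b : OrthonormalBasis (Fin N) 𝕜 (EuclideanSpace 𝕜 (Fin N)) :=
    InnerProductSpace.gramSchmidtOrthonormalBasis (by simp) f
  let V : Matrix (Fin N) (Fin N) 𝕜 := Matrix.of fun i j => b i j
  have hV : V ∈ Matrix.unitaryGroup (Fin N) 𝕜 := by
    rw [Matrix.mem_unitaryGroup_iff]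
    ext i j
    have h1 := orthonormal_iff_ite.1 b.orthonormal j i
    rw [Matrix.mul_apply, Matrix.one_apply]
    simp only [PiLp.inner_apply, RCLike.inner_apply] at h1
    simp only [V, Matrix.of_apply, Matrix.star_apply]
    exact h1.trans (by simp [eq_comm])
  refine ⟨Matrix.of fun a c => inner 𝕜 (b (Fin.castLE h c)) (f (Fin.castLE h a)), ⟨V, hV⟩, ?_⟩
  ext a j
  have h1 := congrArg (fun v : EuclideanSpace 𝕜 (Fin N) => v j) (b.sum_repr' (f (Fin.castLE h a)))
  have h2 : (f (Fin.castLE h a)) j = X a j := by simp [f]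
  simp only [h2, WithLp.ofLp_sum, Finset.sum_apply, WithLp.ofLp_smul, Pi.smul_apply,
    smul_eq_mul] at h1
  rw [← h1, Matrix.mul_apply]
  simp only [topRows, Matrix.submatrix_apply, Matrix.of_apply, V, id]
  rw [← Finset.sum_image (s := Finset.univ) (g := Fin.castLE h)
    (f := fun i => inner 𝕜 (b i) (f (Fin.castLE h a)) * b i j)
    (fun _ _ _ _ hxy => Fin.castLE_injective h hxy)]
  symm
  refine Finset.sum_subset (Finset.subset_univ _) fun i _ hi => ?_
  -- Row a is orthogonal to every later basis vector, so the vectors with index at least r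
  -- contribute nothing.
  have hlt : Fin.castLE h a < i := by
    rw [Fin.lt_def]
    by_contra hle
    apply hi
    rw [Finset.mem_image]
    have : (i : ℕ) < r := by simp only [Fin.val_castLE] at hle; omega
    exact ⟨⟨i, this⟩, Finset.mem_univ _, rfl⟩
  rw [InnerProductSpace.gramSchmidtOrthonormalBasis_inv_triangular _ _ hlt, zero_mul]

/-- The absolute value of the Gram determinant of the rows. -/
noncomputable def gramDet (X : Fin r → Fin N → 𝕜) : ℝ≥0∞ :=
  ‖(Matrix.of X * (Matrix.of X)ᴴ).det‖ₑ

lemma topRows_mul_conjTranspose (h : r ≤ N) (V : UGroup 𝕜 N) :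
    topRows h (V : Matrix (Fin N) (Fin N) 𝕜) * (topRows h (V : Matrix (Fin N) (Fin N) 𝕜))ᴴ = 1 := by
  ext i j
  have h0 : (V : Matrix (Fin N) (Fin N) 𝕜) * star (V : Matrix (Fin N) (Fin N) 𝕜) = 1 :=
    Unitary.mul_star_self_of_mem V.2
  have h1 : ((V : Matrix (Fin N) (Fin N) 𝕜) * star (V : Matrix (Fin N) (Fin N) 𝕜))
      (Fin.castLE h i) (Fin.castLE h j) =
      (1 : Matrix (Fin N) (Fin N) 𝕜) (Fin.castLE h i) (Fin.castLE h j) := by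
    rw [h0]
  rw [Matrix.mul_apply, Matrix.one_apply] at h1
  rw [Matrix.mul_apply, Matrix.one_apply]
  exact h1.trans (by simp)

lemma enorm_star_rclike (z : 𝕜) : ‖star z‖ₑ = ‖z‖ₑ := by
  rw [← ofReal_norm, ← ofReal_norm, norm_star]

lemma enorm_det_mul_conjTranspose {m : ℕ} (T : Matrix (Fin m) (Fin m) 𝕜) :
    ‖(T * Tᴴ).det‖ₑ = ‖T.det‖ₑ ^ 2 := by
  rw [det_mul, det_conjTranspose, enorm_mul, sq, enorm_star_rclike]

lemma gramDet_of_eq_mul_topRows (h : r ≤ N) {X : Fin r → Fin N → 𝕜} {T : Matrix (Fin r) (Fin r) 𝕜}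
    {V : UGroup 𝕜 N} (hX : Matrix.of X = T * topRows h (V : Matrix (Fin N) (Fin N) 𝕜)) :
    gramDet X = ‖T.det‖ₑ ^ 2 := by
  rw [← enorm_det_mul_conjTranspose]
  unfold gramDet
  rw [hX, conjTranspose_mul, Matrix.mul_assoc, ← Matrix.mul_assoc (topRows _ _),
    topRows_mul_conjTranspose, Matrix.one_mul]

/-- Adding a row multiplies the Gram determinant by the squared distance to the other rows. -/
lemma gramDet_snoc (h' : r ≤ N) {X : Fin r → Fin N → 𝕜} {T : Matrix (Fin r) (Fin r) 𝕜}
    {V : UGroup 𝕜 N} (hX' : Matrix.of X = T * topRows h' (V : Matrix (Fin N) (Fin N) 𝕜))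
    (y : Fin N → 𝕜) :
    gramDet (Fin.snoc (α := fun _ => Fin N → 𝕜) X (y ᵥ* (V : Matrix (Fin N) (Fin N) 𝕜))) =
      ‖T.det‖ₑ ^ 2 * ∑ j ∈ Finset.univ.filter (fun j : Fin N => r ≤ (j : ℕ)), ‖y j‖ₑ ^ 2 := by
  -- The enlarged matrix is L R V. The last row of L holds the first r coordinates of y, and the
  -- last row of R the remaining ones; so det L = det T, and the rows of R are orthogonal.
  let L : Matrix (Fin (r + 1)) (Fin (r + 1)) 𝕜 := Matrix.of
    (Fin.snoc (α := fun _ => Fin (r + 1) → 𝕜) (fun a => Fin.snoc (α := fun _ => 𝕜) (T a) 0)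
      (Fin.snoc (α := fun _ => 𝕜) (fun b => y (Fin.castLE h' b)) 1))
  let R : Matrix (Fin (r + 1)) (Fin N) 𝕜 := Matrix.of
    (Fin.snoc (α := fun _ => Fin N → 𝕜) (fun b => Pi.single (Fin.castLE h' b) 1)
      (fun j => if r ≤ (j : ℕ) then y j else 0))
  have hlt : ∀ b : Fin r, ¬ r ≤ ((Fin.castLE h' b : Fin N) : ℕ) := fun b => by
    have := b.isLt
    simp only [Fin.val_castLE]
    omega
  have hX : Matrix.of (Fin.snoc (α := fun _ => Fin N → 𝕜) X
        (y ᵥ* (V : Matrix (Fin N) (Fin N) 𝕜))) = L * R * (V : Matrix (Fin N) (Fin N) 𝕜) := by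
    ext i j
    refine Fin.lastCases ?_ (fun a => ?_) i
    · have hy : (L * R) (Fin.last r) = y := by
        funext k
        rw [Matrix.mul_apply, Fin.sum_univ_castSucc]
        simp only [L, R, Matrix.of_apply, Fin.snoc_last, Fin.snoc_castSucc, one_mul]
        by_cases hk : r ≤ (k : ℕ)
        · rw [if_pos hk, Finset.sum_eq_zero, zero_add]
          intro b _
          rw [Pi.single_eq_of_ne, mul_zero]
          rintro rfl
          exact hlt b hk
        · rw [if_neg hk, add_zero, Finset.sum_eq_single ⟨k, not_le.1 hk⟩]
          · simp
          · intro b _ hb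
            rw [Pi.single_eq_of_ne, mul_zero]
            rintro rfl
            exact hb rfl
          · simp
      rw [Matrix.mul_apply]
      simp only [hy, Matrix.of_apply, Fin.snoc_last]
      rfl
    · have hy : ∀ k, (L * R) a.castSucc k =
          ∑ b, T a b * (Pi.single (Fin.castLE h' b) 1 : Fin N → 𝕜) k := by
        intro k
        rw [Matrix.mul_apply, Fin.sum_univ_castSucc]
        simp [L, R]
      rw [Matrix.mul_apply]
      simp only [hy, Matrix.of_apply, Fin.snoc_castSucc]
      simp only [Finset.sum_mul]
      rw [Finset.sum_comm, ← Matrix.of_apply X, hX', Matrix.mul_apply]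
      refine Finset.sum_congr rfl fun b _ => ?_
      rw [Finset.sum_eq_single (Fin.castLE h' b)]
      · simp [topRows]
      · intro k _ hk
        simp [Pi.single_eq_of_ne hk]
      · simp
  have hL : L.det = T.det := by
    rw [Matrix.det_succ_column L (Fin.last r), Fin.sum_univ_castSucc, Finset.sum_eq_zero, zero_add]
    · have hsub : L.submatrix (Fin.last r).succAbove (Fin.last r).succAbove = T := by
        ext a b
        simp [L]
      rw [hsub]
      simp [L, ← two_mul]
    · intro a _
      simp [L]
  have hR : R * Rᴴ = Matrix.diagonal (Fin.snoc (α := fun _ => 𝕜) (fun _ : Fin r => 1)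
      ((∑ j ∈ Finset.univ.filter (fun j : Fin N => r ≤ (j : ℕ)), ‖y j‖ ^ 2 : ℝ) : 𝕜)) := by
    ext i j
    rw [Matrix.mul_apply]
    simp only [Matrix.conjTranspose_apply]
    refine Fin.lastCases ?_ (fun a => ?_) i <;> refine Fin.lastCases ?_ (fun b => ?_) j
    · simp only [R, Matrix.of_apply, Fin.snoc_last, Matrix.diagonal_apply_eq, RCLike.ofReal_sum]
      rw [Finset.sum_filter]
      refine Finset.sum_congr rfl fun k _ => ?_
      split_ifs
      · rw [← starRingEnd_apply, RCLike.mul_conj]; simp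
      · simp
    · rw [Matrix.diagonal_apply_ne _ (Fin.castSucc_lt_last b).ne']
      refine Finset.sum_eq_zero fun k _ => ?_
      simp only [R, Matrix.of_apply, Fin.snoc_last, Fin.snoc_castSucc]
      by_cases hk : k = Fin.castLE h' b
      · rw [hk, if_neg (hlt b), zero_mul]
      · rw [Pi.single_eq_of_ne hk, star_zero, mul_zero]
    · rw [Matrix.diagonal_apply_ne _ (Fin.castSucc_lt_last a).ne]
      refine Finset.sum_eq_zero fun k _ => ?_
      simp only [R, Matrix.of_apply, Fin.snoc_last, Fin.snoc_castSucc]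
      by_cases hk : k = Fin.castLE h' a
      · rw [hk, if_neg (hlt a), star_zero, mul_zero]
      · rw [Pi.single_eq_of_ne hk, zero_mul]
    · rw [Finset.sum_eq_single (Fin.castLE h' a)]
      · simp only [R, Matrix.of_apply, Fin.snoc_castSucc, Pi.single_eq_same, one_mul,
          Matrix.diagonal_apply, Pi.single_apply, Fin.castSucc_inj, Fin.castLE_inj]
        split_ifs <;> simp
      · intro k _ hk
        simp [R, Pi.single_eq_of_ne hk]
      · simp
  have hG : L * R * (V : Matrix (Fin N) (Fin N) 𝕜) * (L * R * (V : Matrix (Fin N) (Fin N) 𝕜))ᴴ =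
      L * (R * Rᴴ) * Lᴴ := by
    rw [conjTranspose_mul, conjTranspose_mul, Matrix.mul_assoc (L * R),
      ← Matrix.mul_assoc (V : Matrix (Fin N) (Fin N) 𝕜), ← star_eq_conjTranspose,
      Unitary.mul_star_self_of_mem V.2, Matrix.one_mul]
    simp only [Matrix.mul_assoc]
  rw [gramDet, hX, hG, hR, det_mul, det_mul, det_diagonal, det_conjTranspose, hL, enorm_mul,
    enorm_mul, enorm_star_rclike, Fin.prod_univ_castSucc]
  simp only [Fin.snoc_castSucc, Fin.snoc_last, Finset.prod_const_one, one_mul]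
  have hs : ‖((∑ j ∈ Finset.univ.filter (fun j : Fin N => r ≤ (j : ℕ)), ‖y j‖ ^ 2 : ℝ) : 𝕜)‖ₑ =
      ∑ j ∈ Finset.univ.filter (fun j : Fin N => r ≤ (j : ℕ)), ‖y j‖ₑ ^ 2 := by
    rw [← ofReal_norm, RCLike.norm_ofReal,
      abs_of_nonneg (Finset.sum_nonneg fun _ _ => by positivity),
      ENNReal.ofReal_sum_of_nonneg fun _ _ => by positivity]
    simp_rw [ENNReal.ofReal_pow (norm_nonneg _), ofReal_norm]
  rw [hs]
  ring

end Decomposition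
end BlockMoment

namespace BlockMoment
open ProbabilityTheory Matrix
open scoped ENNReal

/-! ### Moments of the Gaussian Gram determinant. -/

section Wishart

lemma continuous_gramDet {𝕜 : Type} [RCLike 𝕜] {r N : ℕ} :
    Continuous (gramDet : (Fin r → Fin N → 𝕜) → ℝ≥0∞) := by
  have h : Continuous fun X : Fin r → Fin N → 𝕜 => (Matrix.of X * (Matrix.of X)ᴴ).det := by
    have h1 : Continuous fun X : Fin r → Fin N → 𝕜 => Matrix.of X := continuous_id
    fun_prop
  exact h.enorm

lemma card_filter_le_val (N r : ℕ) :
    (Finset.univ.filter fun j : Fin N => r ≤ (j : ℕ)).card = N - r := by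
  have h1 := Finset.card_filter_add_card_filter_not (s := (Finset.univ : Finset (Fin N)))
    (fun j => (j : ℕ) < r)
  simp only [Fin.card_filter_val_lt, not_lt, Finset.card_univ, Fintype.card_fin] at h1
  omega

variable {𝕜 : Type} [RCLike 𝕜] [MeasurableSpace 𝕜] [BorelSpace 𝕜] {N : ℕ}

/-- The moments of the Gram determinant of a Gaussian matrix. -/
theorem lintegral_gramDet_pow (K : ℕ) : ∀ r : ℕ, r ≤ N →
    ∫⁻ X, gramDet X ^ K ∂(matrixLaw r N (scalarGaussian 𝕜)) =
      ∏ i ∈ Finset.range r,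
        ENNReal.ofReal (2 ^ K * rising (((N - i : ℕ) : ℝ) * (Module.finrank ℝ 𝕜 / 2)) K) := by
  intro r
  induction r with
  | zero =>
    intro _
    simp [gramDet]
  | succ r ih =>
    intro hr
    have h' : r ≤ N := Nat.le_of_succ_le hr
    let ν : Measure (Fin N → 𝕜) := Measure.pi fun _ => scalarGaussian 𝕜
    have hm := (measurePreserving_piFinSuccAbove (fun _ : Fin (r + 1) => ν) (Fin.last r)).symm
    rw [← hm.lintegral_comp (continuous_gramDet.measurable.pow_const K), lintegral_prod_symm]
    swap
    · exact ((continuous_gramDet.measurable.pow_const K).comp hm.measurable).aemeasurable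
    have hinner : ∀ X : Fin r → Fin N → 𝕜,
        ∫⁻ x, gramDet ((MeasurableEquiv.piFinSuccAbove (fun _ => Fin N → 𝕜) (Fin.last r)).symm
          (x, X)) ^ K ∂ν = gramDet X ^ K *
          ENNReal.ofReal (2 ^ K * rising (((N - r : ℕ) : ℝ) * (Module.finrank ℝ 𝕜 / 2)) K) := by
      intro X
      -- For fixed X the last row may be rotated by V. Its squared distance to the other rows is
      -- then a sum of N - r squared coordinates, whose law does not involve X.
      obtain ⟨T, V, hX⟩ := exists_eq_mul_topRows h' (Matrix.of X)
      have hcont : Measurable fun x : Fin N → 𝕜 =>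
          gramDet (Fin.snoc (α := fun _ => Fin N → 𝕜) X x) ^ K := by
        refine ((continuous_gramDet.comp ?_).measurable).pow_const K
        fun_prop
      calc _ = ∫⁻ x, gramDet (Fin.snoc (α := fun _ => Fin N → 𝕜) X x) ^ K ∂ν := by
            refine lintegral_congr fun x => ?_
            rw [MeasurableEquiv.piFinSuccAbove_symm_apply]
            simp [Fin.insertNthEquiv, Fin.insertNth_last']
        _ = ∫⁻ y, gramDet (Fin.snoc (α := fun _ => Fin N → 𝕜) X
              (y ᵥ* (V : Matrix (Fin N) (Fin N) 𝕜))) ^ K ∂ν :=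
            ((map_vecMul_pi_scalarGaussian V).lintegral_comp hcont).symm
        _ = ∫⁻ y, gramDet X ^ K *
              (∑ j ∈ Finset.univ.filter (fun j : Fin N => r ≤ (j : ℕ)), ‖y j‖ₑ ^ 2) ^ K ∂ν := by
            refine lintegral_congr fun y => ?_
            rw [gramDet_snoc h' hX, gramDet_of_eq_mul_topRows h' hX, mul_pow]
        _ = _ := by
            rw [lintegral_const_mul _ (by fun_prop), lintegral_sum_enorm_pow_pi_scalarGaussian]
            rw [card_filter_le_val]
    simp_rw [hinner]
    rw [lintegral_mul_const _ (continuous_gramDet.measurable.pow_const K), Finset.prod_range_succ]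
    congr 1
    exact ih h'

end Wishart

/-! ### Separating the Gram factor from the Haar factor. -/

section Haar

lemma continuous_blockDet {𝕜 : Type} [RCLike 𝕜] {r n : ℕ} {α : Type*} [TopologicalSpace α]
    (lam : Fin n × Fin r → 𝕜)
    {x : α → Fin n × Fin r → Fin r → 𝕜} (hx : ∀ i l, Continuous fun a => x a i l) :
    Continuous fun a => blockDet lam (x a) := by
  simp_rw [blockDet_eq_sum]
  fun_prop

variable {𝕜 : Type} [RCLike 𝕜] [MeasurableSpace 𝕜] [BorelSpace 𝕜] {r N n : ℕ}

/-- A Gaussian matrix factors into its Gram determinant and a Haar distributed part. -/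
theorem lintegral_blockDet_pow_eq_mul (h : r ≤ N) (k : ℕ) (lam : Fin n × Fin r → 𝕜)
    (e : Fin n × Fin r ≃ Fin N) :
    ∫⁻ X, ‖blockDet lam (fun i a => X a (e i))‖ₑ ^ (2 * k) ∂(matrixLaw r N (scalarGaussian 𝕜)) =
      (∫⁻ X, gramDet X ^ (n * k) ∂(matrixLaw r N (scalarGaussian 𝕜))) *
        ∫⁻ U : UGroup 𝕜 N,
          ‖blockDet lam (fun i a => (U : Matrix (Fin N) (Fin N) 𝕜) (Fin.castLE h a) (e i))‖ₑ ^
            (2 * k) ∂(haarU 𝕜 N) := by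
  let μ := matrixLaw r N (scalarGaussian 𝕜)
  let F : (Fin r → Fin N → 𝕜) → ℝ≥0∞ := fun X => ‖blockDet lam (fun i a => X a (e i))‖ₑ ^ (2 * k)
  have hFc : Continuous F :=
    (ENNReal.continuous_pow _).comp (continuous_blockDet lam fun i l => by fun_prop).enorm
  let act : (Fin r → Fin N → 𝕜) → UGroup 𝕜 N → Fin r → Fin N → 𝕜 := fun X U a =>
    X a ᵥ* (U : Matrix (Fin N) (Fin N) 𝕜)
  have hact : Continuous (Function.uncurry act) := by
    have : Continuous fun p : (Fin r → Fin N → 𝕜) × UGroup 𝕜 N =>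
        (p.2 : Matrix (Fin N) (Fin N) 𝕜) := continuous_subtype_val.comp continuous_snd
    refine continuous_pi fun a => ?_
    exact Continuous.matrix_vecMul (by fun_prop) this
  have h1 : ∀ U : UGroup 𝕜 N, ∫⁻ X, F (act X U) ∂μ = ∫⁻ X, F X ∂μ := fun U =>
    (measurePreserving_pi _ _ fun _ => map_vecMul_pi_scalarGaussian U).lintegral_comp
      hFc.measurable
  have h2 : ∀ X : Fin r → Fin N → 𝕜, ∫⁻ U, F (act X U) ∂(haarU 𝕜 N) = gramDet X ^ (n * k) *
      ∫⁻ U : UGroup 𝕜 N,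
        F (fun a => (U : Matrix (Fin N) (Fin N) 𝕜) (Fin.castLE h a)) ∂(haarU 𝕜 N) := by
    intro X
    obtain ⟨T, V, hX⟩ := exists_eq_mul_topRows h (Matrix.of X)
    have h3 : ∀ U : UGroup 𝕜 N, F (act X U) = gramDet X ^ (n * k) *
        F (fun a => ((V * U : UGroup 𝕜 N) : Matrix (Fin N) (Fin N) 𝕜) (Fin.castLE h a)) := by
      intro U
      have h4 : (fun i a => act X U a (e i)) = fun i =>
          (fun a => ((V * U : UGroup 𝕜 N) : Matrix (Fin N) (Fin N) 𝕜) (Fin.castLE h a) (e i)) ᵥ*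
            Tᵀ := by
        funext i a
        have hVU : topRows h ((V * U : UGroup 𝕜 N) : Matrix (Fin N) (Fin N) 𝕜) =
            topRows h (V : Matrix (Fin N) (Fin N) 𝕜) * (U : Matrix (Fin N) (Fin N) 𝕜) := by
          ext b j
          simp [topRows, Matrix.mul_apply]
        have h5 : act X U a (e i) = (Matrix.of X * (U : Matrix (Fin N) (Fin N) 𝕜)) a (e i) := by
          simp [act, Matrix.mul_apply, vecMul, dotProduct]
        rw [h5, hX, Matrix.mul_assoc, ← hVU, Matrix.vecMul_transpose]
        rfl
      simp only [F]
      rw [h4, blockDet_vecMul, det_transpose, enorm_mul, enorm_pow, mul_pow,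
        gramDet_of_eq_mul_topRows h hX]
      ring
    simp_rw [h3]
    -- Left invariance of Haar measure absorbs V.
    rw [lintegral_const_mul', lintegral_mul_left_eq_self (μ := haarU 𝕜 N)
      (fun U : UGroup 𝕜 N => F (fun a => (U : Matrix (Fin N) (Fin N) 𝕜) (Fin.castLE h a))) V]
    rw [gramDet]
    exact ENNReal.pow_ne_top enorm_ne_top
  -- The Gaussian integral is the same for every U, so it can be averaged over U before Tonelli
  -- exchanges the integrals.
  calc ∫⁻ X, F X ∂μ = ∫⁻ U, ∫⁻ X, F (act X U) ∂μ ∂(haarU 𝕜 N) := by simp [h1]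
    _ = ∫⁻ X, ∫⁻ U, F (act X U) ∂(haarU 𝕜 N) ∂μ :=
        (lintegral_lintegral_swap (f := fun X U => F (act X U))
          (hFc.comp hact).measurable.aemeasurable).symm
    _ = _ := by
        simp_rw [h2]
        rw [lintegral_mul_const _ (continuous_gramDet.measurable.pow_const _)]

end Haar
end BlockMoment

namespace BlockMoment
open ProbabilityTheory Matrix
open scoped ENNReal ComplexConjugate

/-! ### Mixed moments of a scalar Gaussian. -/

section ScalarMoments

lemma continuous_monomial {𝕜 : Type} [RCLike 𝕜] (p q : ℕ) :
    Continuous fun z : 𝕜 => z ^ p * conj z ^ q :=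
  (continuous_id.pow p).mul (RCLike.continuous_conj.pow q)

lemma rising_finrank_nonneg (𝕜 : Type) [RCLike 𝕜] (K : ℕ) :
    0 ≤ 2 ^ K * rising (Module.finrank ℝ 𝕜 / 2) K :=
  mul_nonneg (by positivity) (rising_nonneg (by positivity) K)

variable {𝕜 : Type} [RCLike 𝕜] [MeasurableSpace 𝕜] [BorelSpace 𝕜]

lemma lintegral_enorm_pow_scalarGaussian (K : ℕ) :
    ∫⁻ z, (‖z‖ₑ ^ 2) ^ K ∂(scalarGaussian 𝕜) =
      ENNReal.ofReal (2 ^ K * rising (Module.finrank ℝ 𝕜 / 2) K) :=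
  lintegral_enorm_pow_stdGaussian K

lemma integrable_norm_pow_scalarGaussian (K : ℕ) :
    Integrable (fun z : 𝕜 => ‖z‖ ^ (2 * K)) (scalarGaussian 𝕜) := by
  refine ⟨by fun_prop, ?_⟩
  have h := lintegral_enorm_pow_scalarGaussian (𝕜 := 𝕜) K
  rw [HasFiniteIntegral]
  have h1 : ∀ z : 𝕜, ‖‖z‖ ^ (2 * K)‖ₑ = (‖z‖ₑ ^ 2) ^ K := fun z => by
    rw [enorm_pow, enorm_norm, pow_mul]
  simp_rw [h1, h]
  exact ENNReal.ofReal_lt_top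

lemma integral_norm_pow_scalarGaussian (K : ℕ) :
    ∫ z, ‖z‖ ^ (2 * K) ∂(scalarGaussian 𝕜) = 2 ^ K * rising (Module.finrank ℝ 𝕜 / 2) K := by
  rw [← ENNReal.ofReal_eq_ofReal_iff (integral_nonneg fun z => by positivity)
    (rising_finrank_nonneg 𝕜 K), ← lintegral_enorm_pow_scalarGaussian,
    ofReal_integral_eq_lintegral_ofReal (integrable_norm_pow_scalarGaussian K)
      (ae_of_all _ fun z => by positivity)]
  refine lintegral_congr fun z => ?_
  rw [pow_mul, ENNReal.ofReal_pow (by positivity), ENNReal.ofReal_pow (by positivity), ofReal_norm]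

lemma integrable_monomial_scalarGaussian (p q : ℕ) :
    Integrable (fun z : 𝕜 => z ^ p * conj z ^ q) (scalarGaussian 𝕜) := by
  refine ((integrable_norm_pow_scalarGaussian (𝕜 := 𝕜) (p + q)).add (integrable_const 1)).mono'
    (continuous_monomial p q).aestronglyMeasurable (ae_of_all _ fun z => ?_)
  rw [norm_mul, norm_pow, norm_pow, RCLike.norm_conj, ← pow_add]
  simp only [Pi.add_apply, mul_comm 2, pow_mul]
  nlinarith [sq_nonneg (‖z‖ ^ (p + q) - 1), sq_nonneg (‖z‖ ^ (p + q))]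

lemma mixedMoment_self (p : ℕ) : mixedMoment (scalarGaussian 𝕜) p p =
    ((2 ^ p * rising (Module.finrank ℝ 𝕜 / 2) p : ℝ) : 𝕜) := by
  rw [← integral_norm_pow_scalarGaussian, ← integral_ofReal, mixedMoment]
  congr 1
  funext z
  rw [← mul_pow, RCLike.mul_conj, pow_mul]
  push_cast
  rfl

/-- Multiplication by u is a 1 × 1 unitary matrix. Taking u = -1 kills odd moments, and u = i kills
the complex moments (2, 0) and (0, 2). -/
lemma mixedMoment_rotate (u : 𝕜) (hu : ‖u‖ = 1) (p q : ℕ) :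
    mixedMoment (scalarGaussian 𝕜) p q =
      u ^ p * conj u ^ q * mixedMoment (scalarGaussian 𝕜) p q := by
  have hU : Matrix.diagonal (fun _ : Fin 1 => u) ∈ Matrix.unitaryGroup (Fin 1) 𝕜 := by
    rw [Matrix.mem_unitaryGroup_iff, Matrix.star_eq_conjTranspose, Matrix.diagonal_conjTranspose,
      Matrix.diagonal_mul_diagonal]
    simp [RCLike.mul_conj, hu]
  have hm := map_vecMul_pi_scalarGaussian (𝕜 := 𝕜) ⟨_, hU⟩
  have he := measurePreserving_eval (fun _ : Fin 1 => scalarGaussian 𝕜) 0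
  have hcomp : MeasurePreserving (fun z : 𝕜 => z * u) (scalarGaussian 𝕜) (scalarGaussian 𝕜) := by
    refine ⟨by fun_prop, ?_⟩
    have h0 : (fun z : 𝕜 => z * u) ∘ Function.eval 0 = Function.eval 0 ∘ fun x : Fin 1 → 𝕜 =>
        x ᵥ* Matrix.diagonal (fun _ : Fin 1 => u) := by
      funext x
      simp [mul_comm]
    calc (scalarGaussian 𝕜).map (fun z => z * u)
        = ((Measure.pi fun _ : Fin 1 => scalarGaussian 𝕜).map (Function.eval 0)).map
            (fun z => z * u) := by rw [he.map_eq]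
      _ = scalarGaussian 𝕜 := by
          rw [Measure.map_map (by fun_prop) he.measurable, h0]
          exact (he.comp hm).map_eq
  have h2 : ∫ z, z ^ p * conj z ^ q ∂(scalarGaussian 𝕜) =
      ∫ z, (z * u) ^ p * conj (z * u) ^ q ∂(scalarGaussian 𝕜) := by
    conv_lhs => rw [← hcomp.map_eq]
    rw [integral_map hcomp.measurable.aemeasurable (continuous_monomial p q).aestronglyMeasurable]
  rw [mixedMoment]
  conv_lhs => rw [h2]
  rw [← integral_const_mul]
  congr 1
  funext z
  rw [map_mul]
  ring

lemma mixedMoment_eq_zero_of_odd {p q : ℕ} (h : Odd (p + q)) :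
    mixedMoment (scalarGaussian 𝕜) p q = 0 := by
  have h1 := mixedMoment_rotate (-1 : 𝕜) (by simp) p q
  rw [map_neg, map_one, ← pow_add, h.neg_one_pow, neg_one_mul] at h1
  exact self_eq_neg.1 h1

lemma mixedMoment_zero_zero : mixedMoment (scalarGaussian 𝕜) 0 0 = 1 := by
  simp [mixedMoment]

lemma mixedMoment_one_one :
    mixedMoment (scalarGaussian 𝕜) 1 1 = (Module.finrank ℝ 𝕜 : 𝕜) := by
  rw [mixedMoment_self]
  simp [rising, mul_div_cancel₀]

end ScalarMoments

/-! ### Haar moments as discrete moments. -/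

section HaarMoment

variable {𝕜 : Type} [RCLike 𝕜] [MeasurableSpace 𝕜] [BorelSpace 𝕜] {r N n : ℕ}

/-- The Haar moment of the block determinant as a discrete moment. -/
theorem integral_haarU_blockDet {W : Type} [Fintype W] (h : r ≤ N) (hpos : 0 < Module.finrank ℝ 𝕜)
    (k : ℕ) (w : W → ℝ)
    (x : W → Fin r → 𝕜) (hm : MomentsMatch k (scalarGaussian 𝕜) w x)
    (lam : Fin n × Fin r → ℝ) (e : Fin n × Fin r ≃ Fin N) :
    Integrable (fun U : UGroup 𝕜 N => ‖blockDet (fun i => (lam i : 𝕜))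
      (fun i a => (U : Matrix (Fin N) (Fin N) 𝕜) (Fin.castLE h a) (e i))‖ ^ (2 * k)) (haarU 𝕜 N) ∧
    ∫ U : UGroup 𝕜 N, ‖blockDet (fun i => (lam i : 𝕜))
      (fun i a => (U : Matrix (Fin N) (Fin N) 𝕜) (Fin.castLE h a) (e i))‖ ^ (2 * k) ∂(haarU 𝕜 N) =
      discreteMoment (2 * k) w x lam *
        ∏ i ∈ Finset.range r,
          (2 ^ (n * k) * rising (((N - i : ℕ) : ℝ) * (Module.finrank ℝ 𝕜 / 2)) (n * k))⁻¹ := by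
  have hcoe : Continuous fun U : UGroup 𝕜 N => (U : Matrix (Fin N) (Fin N) 𝕜) :=
    continuous_subtype_val
  have hcont : Continuous fun U : UGroup 𝕜 N => ‖blockDet (fun i => (lam i : 𝕜))
      (fun i a => (U : Matrix (Fin N) (Fin N) 𝕜) (Fin.castLE h a) (e i))‖ ^ (2 * k) :=
    (continuous_blockDet _ fun i l => hcoe.matrix_elem _ _).norm.pow _
  have hint : Integrable (fun U : UGroup 𝕜 N => ‖blockDet (fun i => (lam i : 𝕜))
      (fun i a => (U : Matrix (Fin N) (Fin N) 𝕜) (Fin.castLE h a) (e i))‖ ^ (2 * k)) (haarU 𝕜 N) :=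
    hcont.integrable_of_hasCompactSupport (HasCompactSupport.of_compactSpace _)
  refine ⟨hint, ?_⟩
  obtain ⟨hgi, hg⟩ := integral_norm_blockDet_pow (scalarGaussian 𝕜)
    integrable_monomial_scalarGaussian w x hm e lam
  have hkey := lintegral_blockDet_pow_eq_mul h k (fun i => (lam i : 𝕜)) e
  -- Positivity of the Gram factors allows the final division.
  have hrp : ∀ i ∈ Finset.range r, 0 < 2 ^ (n * k) *
      rising (((N - i : ℕ) : ℝ) * (Module.finrank ℝ 𝕜 / 2)) (n * k) := by
    intro i hi
    have hi' : 0 < N - i := by have := Finset.mem_range.1 hi; omega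
    exact mul_pos (by positivity) (rising_pos (by positivity) _)
  rw [lintegral_gramDet_pow _ r h, ← ENNReal.ofReal_prod_of_nonneg fun i hi =>
    (hrp i hi).le] at hkey
  have hpow : ∀ z : 𝕜, ‖z‖ₑ ^ (2 * k) = ENNReal.ofReal (‖z‖ ^ (2 * k)) := fun z => by
    rw [ENNReal.ofReal_pow (norm_nonneg _), ofReal_norm]
  simp_rw [hpow] at hkey
  rw [← ofReal_integral_eq_lintegral_ofReal hgi (ae_of_all _ fun _ => by positivity),
    ← ofReal_integral_eq_lintegral_ofReal hint (ae_of_all _ fun _ => by positivity), hg,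
    ← ENNReal.ofReal_mul (Finset.prod_nonneg fun i hi => (hrp i hi).le),
    ENNReal.ofReal_eq_ofReal_iff (hg ▸ integral_nonneg fun _ => by positivity)
      (mul_nonneg (Finset.prod_nonneg fun i hi => (hrp i hi).le)
        (integral_nonneg fun _ => by positivity))] at hkey
  rw [hkey, Finset.prod_inv_distrib, mul_comm (∏ i ∈ Finset.range r, _), mul_assoc,
    mul_inv_cancel₀ (Finset.prod_pos hrp).ne', mul_one]

end HaarMoment

/-! ### From M(λ, X) to the block determinant. -/

section Magic

/-- The enumeration of the columns of the block matrix. -/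
def columnEquiv (r n : ℕ) : Fin n × Fin r ≃ Fin (r * n) :=
  finProdFinEquiv.trans (finCongr (mul_comm n r))

variable {𝕜 : Type} [RCLike 𝕜] {r n : ℕ}

lemma det_magicMatrix (h : r ≤ r * n) (lam : Fin (r * n) → ℝ)
    (X : Matrix (Fin (r * n)) (Fin (r * n)) 𝕜) :
    (magicMatrix 𝕜 r n lam X).det = blockDet (fun i => (lam (columnEquiv r n i) : 𝕜))
      (fun i a => X (Fin.castLE h a) (columnEquiv r n i)) := by
  rw [← Matrix.det_submatrix_equiv_self (columnEquiv r n), blockDet]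
  congr 1
  ext i j
  have hr : 0 < r := j.2.pos
  have hv : ((columnEquiv r n j : Fin (r * n)) : ℕ) = j.2 + r * j.1 := by simp [columnEquiv]
  have h1 : ((columnEquiv r n j : Fin (r * n)) : ℕ) / r = j.1 := by
    rw [hv, Nat.add_mul_div_left _ _ hr, Nat.div_eq_of_lt j.2.isLt, zero_add]
  have h2 : ((columnEquiv r n j : Fin (r * n)) : ℕ) % r = j.2 := by
    rw [hv, Nat.add_mul_mod_self_left, Nat.mod_eq_of_lt j.2.isLt]
  simp only [Matrix.submatrix_apply, magicMatrix, Matrix.of_apply, h1]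
  congr 2
  ext
  exact h2

end Magic
end BlockMoment

namespace BlockMoment
open ProbabilityTheory Matrix
open scoped ENNReal ComplexConjugate

/-! ### Quadratures with the Gaussian moments. -/

section Quadratures

lemma card_fibre_fin_one {r : ℕ} (u : Fin 1 → Fin r) (b : Fin r) :
    (Finset.univ.filter fun l => u l = b).card = if u 0 = b then 1 else 0 := by
  rw [Finset.card_filter, Fin.sum_univ_one]

lemma card_fibre_fin_two {r : ℕ} (u : Fin 2 → Fin r) (b : Fin r) :
    (Finset.univ.filter fun l => u l = b).card =
      (if u 0 = b then 1 else 0) + if u 1 = b then 1 else 0 := by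
  rw [Finset.card_filter, Fin.sum_univ_two]

/-- The uniformly weighted unit vectors have the second moments of the Gaussian law. -/
lemma momentsMatch_one {𝕜 : Type} [RCLike 𝕜] [MeasurableSpace 𝕜] [BorelSpace 𝕜] (r : ℕ) :
    MomentsMatch 1 (scalarGaussian 𝕜) (fun _ : Fin r => (Module.finrank ℝ 𝕜 : ℝ))
      (fun l => Pi.single l 1) := by
  intro u v
  simp_rw [card_fibre_fin_one, Fin.prod_univ_one]
  rw [Finset.sum_eq_single (u 0)]
  · by_cases h : u 0 = v 0
    · rw [Finset.prod_eq_single (u 0)]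
      · simp [← h, mixedMoment_one_one]
      · intro b _ hb
        simp [← h, hb.symm, mixedMoment_zero_zero]
      · simp
    · rw [Finset.prod_eq_zero (Finset.mem_univ (u 0))]
      · simp [Pi.single_eq_of_ne (Ne.symm h)]
      · rw [if_pos rfl, if_neg (Ne.symm h)]
        exact mixedMoment_eq_zero_of_odd (by decide)
  · intro b _ hb
    simp [Pi.single_eq_of_ne hb.symm]
  · simp

/-- Nodes of a quadrature for fourth moments: the unit vectors and the vectors `(1, ζ j)`. -/
def quadNode {𝕜 : Type} [RCLike 𝕜] {m : ℕ} (ζ : Fin m → 𝕜) : Fin 2 ⊕ Fin m → Fin 2 → 𝕜 :=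
  Sum.elim (fun l => Pi.single l 1) (fun j => ![1, ζ j])

/-- Weights of a quadrature for fourth moments. -/
def quadWeight (m : ℕ) (a b : ℝ) : Fin 2 ⊕ Fin m → ℝ := Sum.elim (fun _ => a) (fun _ => b)

lemma mixedMoment_real_two_zero : mixedMoment (scalarGaussian ℝ) 2 0 = 1 := by
  have h := mixedMoment_one_one (𝕜 := ℝ)
  rw [Module.finrank_self, mixedMoment] at h
  rw [mixedMoment]
  simpa [sq] using h

lemma mixedMoment_real_zero_two : mixedMoment (scalarGaussian ℝ) 0 2 = 1 := by
  have h := mixedMoment_one_one (𝕜 := ℝ)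
  rw [Module.finrank_self, mixedMoment] at h
  rw [mixedMoment]
  simpa [sq] using h

/-- The nodes (1, ±1) with weight 1/2 give the moment 1 of x₀² x₁² and cancel the odd ones; weight 2
on the unit vectors raises the pure fourth moments from 1 to 3. -/
lemma momentsMatch_real : MomentsMatch 2 (scalarGaussian ℝ) (quadWeight 2 2 (1 / 2))
    (quadNode ![1, -1]) := by
  have h01 : mixedMoment (scalarGaussian ℝ) 0 1 = 0 := mixedMoment_eq_zero_of_odd (by decide)
  have h10 : mixedMoment (scalarGaussian ℝ) 1 0 = 0 := mixedMoment_eq_zero_of_odd (by decide)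
  have h12 : mixedMoment (scalarGaussian ℝ) 1 2 = 0 := mixedMoment_eq_zero_of_odd (by decide)
  have h21 : mixedMoment (scalarGaussian ℝ) 2 1 = 0 := mixedMoment_eq_zero_of_odd (by decide)
  have h11 : mixedMoment (scalarGaussian ℝ) 1 1 = 1 := by simp [mixedMoment_one_one]
  have h22 : mixedMoment (scalarGaussian ℝ) 2 2 = 3 := by
    rw [mixedMoment_self]
    norm_num [rising, Finset.prod_range_succ]
  intro u v
  simp_rw [card_fibre_fin_two, Fin.prod_univ_two]
  generalize u 0 = a, u 1 = b, v 0 = c, v 1 = d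
  fin_cases a <;> fin_cases b <;> fin_cases c <;> fin_cases d <;>
    norm_num [Fin.sum_univ_two, quadWeight, quadNode, mixedMoment_zero_zero, h01, h10, h11, h12,
      h21, h22, mixedMoment_real_two_zero, mixedMoment_real_zero_two]

lemma pairMoment_real : pairMoment (quadWeight 2 2 (1 / 2)) (quadNode ![(1 : ℝ), -1]) = 24 := by
  norm_num [pairMoment, Fin.sum_univ_two, quadWeight, quadNode]

/-- The standard Gaussian on ℂ has E|z|² = 2 and E|z|⁴ = 8. The four nodes (1, i^j) give |x₀|² |x₁|²
the value 4 and cancel the unbalanced moments; weight 4 on the unit vectors raises 4 to 8. -/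
lemma momentsMatch_complex : MomentsMatch 2 (scalarGaussian ℂ) (quadWeight 4 4 1)
    (quadNode fun j => Complex.I ^ (j : ℕ)) := by
  have h01 : mixedMoment (scalarGaussian ℂ) 0 1 = 0 := mixedMoment_eq_zero_of_odd (by decide)
  have h10 : mixedMoment (scalarGaussian ℂ) 1 0 = 0 := mixedMoment_eq_zero_of_odd (by decide)
  have h12 : mixedMoment (scalarGaussian ℂ) 1 2 = 0 := mixedMoment_eq_zero_of_odd (by decide)
  have h21 : mixedMoment (scalarGaussian ℂ) 2 1 = 0 := mixedMoment_eq_zero_of_odd (by decide)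
  have h11 : mixedMoment (scalarGaussian ℂ) 1 1 = 2 := by
    rw [mixedMoment_one_one, Complex.finrank_real_complex]
    norm_num
  have h22 : mixedMoment (scalarGaussian ℂ) 2 2 = 8 := by
    rw [mixedMoment_self, Complex.finrank_real_complex]
    norm_num [rising, Finset.prod_range_succ]
  have h20 : mixedMoment (scalarGaussian ℂ) 2 0 = 0 := by
    have h := mixedMoment_rotate Complex.I (by simp) 2 0
    simp only [Complex.I_sq, pow_zero, mul_one, neg_one_mul] at h
    exact self_eq_neg.1 h
  have h02 : mixedMoment (scalarGaussian ℂ) 0 2 = 0 := by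
    have h := mixedMoment_rotate Complex.I (by simp) 0 2
    simp only [Complex.conj_I, neg_sq, Complex.I_sq, pow_zero, one_mul, neg_one_mul] at h
    exact self_eq_neg.1 h
  have hI : (-Complex.I) ^ 3 = Complex.I := by
    rw [Odd.neg_pow (by decide), Complex.I_pow_three, neg_neg]
  intro u v
  simp_rw [card_fibre_fin_two, Fin.prod_univ_two]
  generalize u 0 = a, u 1 = b, v 0 = c, v 1 = d
  fin_cases a <;> fin_cases b <;> fin_cases c <;> fin_cases d <;>
    norm_num [Fin.sum_univ_two, Fin.sum_univ_four, quadWeight, quadNode, mixedMoment_zero_zero,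
      h01, h10, h11, h12, h21, h22, h20, h02, hI]

lemma pairMoment_complex : pairMoment (quadWeight 4 4 1) (quadNode fun j => Complex.I ^ (j : ℕ)) =
    192 := by
  have h2 : ∀ z : ℂ, ‖z‖ ^ 4 = (z.re ^ 2 + z.im ^ 2) ^ 2 := fun z => norm_pow_four_eq z
  simp only [pairMoment, h2]
  norm_num [Fin.sum_univ_two, Fin.sum_univ_four, quadWeight, quadNode]

lemma pairMoment_single {𝕜 : Type} [RCLike 𝕜] :
    pairMoment (fun _ : Fin 2 => 1) (fun l => (Pi.single l 1 : Fin 2 → 𝕜)) = 2 := by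
  norm_num [pairMoment, Fin.sum_univ_two]

end Quadratures

/-! ### The Gamma-product constant. -/

section Constants

/-- Since βsn/2 = nk is an integer, each Gamma quotient is the inverse of a rising factorial. Here n
≥ 1 ensures that the natural subtraction `r * n - i` does not truncate. -/
lemma gammaConst_eq (n r k : ℕ) (hn : 1 ≤ n) {β s : ℝ} (hβ : 0 < β) (h : β * s = 2 * k) :
    gammaConst n β r s = (β / 2) ^ (r * (n * k)) *
      ∏ i ∈ Finset.range r, (rising (((r * n - i : ℕ) : ℝ) * (β / 2)) (n * k))⁻¹ := by
  have h1 : β / 2 * r * s * n = ((r * (n * k) : ℕ) : ℝ) := by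
    push_cast
    linear_combination (r * n / 2 : ℝ) * h
  rw [gammaConst, h1, Real.rpow_natCast, ← Finset.Ico_add_one_right_eq_Icc,
    Finset.prod_Ico_eq_prod_range]
  congr 1
  refine Finset.prod_congr (by simp) fun i hi => ?_
  have hi' : i < r := by simpa using hi
  have hle : r ≤ r * n := Nat.le_mul_of_pos_right r hn
  have hpos : 0 < r * n - i := by omega
  have hcast : ((r * n - i : ℕ) : ℝ) = r * n - i := by
    rw [Nat.cast_sub (by omega)]
    push_cast
    ring
  have ha : 0 < ((r * n - i : ℕ) : ℝ) * (β / 2) := by positivity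
  have h2 : β / 2 * (r * n + 1 - ((1 + i : ℕ) : ℝ)) = ((r * n - i : ℕ) : ℝ) * (β / 2) := by
    rw [hcast]; push_cast; ring
  have h3 : β / 2 * ((r + s) * n + 1 - ((1 + i : ℕ) : ℝ)) =
      ((r * n - i : ℕ) : ℝ) * (β / 2) + ((n * k : ℕ) : ℝ) := by
    rw [hcast]; push_cast; linear_combination (n / 2 : ℝ) * h
  rw [h2, h3, Gamma_add_natCast ha]
  have hG := (Real.Gamma_pos_of_pos ha).ne'
  have hR := (rising_pos ha (n * k)).ne'
  field_simp

end Constants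

/-! ### Assembling the two formulas. -/

section Moments

lemma discreteMoment_const_mul {𝕜 : Type} [RCLike 𝕜] {W : Type} [Fintype W] {n r p : ℕ} (c : ℝ)
    (x : W → Fin r → 𝕜)
    (lam : Fin n × Fin r → ℝ) :
    discreteMoment p (fun _ => c) x lam = c ^ (n * r) * discreteMoment p (fun _ => 1) x lam := by
  simp [discreteMoment, Finset.mul_sum]

lemma discreteMoment_single {𝕜 : Type} [RCLike 𝕜] {n r p : ℕ} (hp : Even p) (hp0 : p ≠ 0)
    (lam : Fin (r * n) → ℝ) :
    discreteMoment p (fun _ : Fin r => 1) (fun l => (Pi.single l 1 : Fin r → 𝕜))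
      (fun i => lam (columnEquiv r n i)) =
      ∑ A ∈ equipartitions r n, ∏ j, vdm lam (A j) ^ p := by
  have h := sum_norm_blockDet_single_pow (𝕜 := 𝕜) lam (columnEquiv r n) hp0
  simp only [hp.pow_abs] at h
  simpa [discreteMoment] using h

variable {𝕜 : Type} [RCLike 𝕜] [MeasurableSpace 𝕜] [BorelSpace 𝕜]

/-- The moment of the determinant for Haar distributed `Q`, as a discrete moment. -/
theorem hasDetMoment_of_momentsMatch {W : Type} [Fintype W] {n r k : ℕ} (hn : 1 ≤ n) {β s : ℝ}
    (hβ : β = Module.finrank ℝ 𝕜) (hβ0 : 0 < β) (h : β * s = 2 * k) (w : W → ℝ)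
    (x : W → Fin r → 𝕜) (hm : MomentsMatch k (scalarGaussian 𝕜) w x) (lam : Fin (r * n) → ℝ) :
    HasDetMoment 𝕜 r n lam (β * s) (gammaConst n β r s * (β ^ (r * (n * k)))⁻¹ *
      discreteMoment (2 * k) w x (fun i => lam (columnEquiv r n i))) := by
  have hle : r ≤ r * n := Nat.le_mul_of_pos_right r hn
  have hpos : 0 < Module.finrank ℝ 𝕜 := by
    rw [hβ] at hβ0
    exact_mod_cast hβ0
  have hps : ∀ z : 𝕜, ‖z‖ ^ (β * s) = ‖z‖ ^ (2 * k) := fun z => by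
    rw [h, ← Real.rpow_natCast]
    push_cast
    rfl
  obtain ⟨h1, h2⟩ := integral_haarU_blockDet hle hpos k w x hm
    (fun i => lam (columnEquiv r n i)) (columnEquiv r n)
  simp only [HasDetMoment, hps, det_magicMatrix hle]
  refine ⟨h1, h2.trans ?_⟩
  -- The Gram factor contributes 2 to the power -rnk where `gammaConst` has (β/2) to the power rnk;
  -- this is the origin of the inverse power of β.
  rw [gammaConst_eq n r k hn hβ0 h, ← hβ]
  simp only [mul_inv, Finset.prod_mul_distrib, Finset.prod_const, Finset.card_range]
  generalize ∏ i ∈ Finset.range r, (rising (((r * n - i : ℕ) : ℝ) * (β / 2)) (n * k))⁻¹ = P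
  rw [div_pow, inv_pow, ← pow_mul, mul_comm (n * k) r]
  field_simp

/-- Weight β on each of the rn columns cancels the inverse power of β exactly. -/
theorem hasDetMoment_two {n r : ℕ} (hn : 1 ≤ n) {β s : ℝ} (hβ : β = Module.finrank ℝ 𝕜)
    (hβ0 : 0 < β) (h : β * s = 2) (lam : Fin (r * n) → ℝ) :
    HasDetMoment 𝕜 r n lam (β * s)
      (gammaConst n β r s * ∑ A ∈ equipartitions r n, ∏ j, vdm lam (A j) ^ 2) := by
  have h1 := hasDetMoment_of_momentsMatch hn hβ hβ0 (k := 1) (by rw [h]; norm_num) _ _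
    (momentsMatch_one (𝕜 := 𝕜) r) lam
  rw [discreteMoment_const_mul, mul_one 2, discreteMoment_single even_two two_ne_zero, ← hβ,
    mul_one n, mul_comm n r] at h1
  convert h1 using 1
  field_simp

/-- The fourth moment, from a quadrature for the fourth moments of the Gaussian law. -/
theorem hasDetMoment_four {W : Type} [Fintype W] {n : ℕ} (hn : 1 ≤ n) {β s : ℝ}
    (hβ : β = Module.finrank ℝ 𝕜) (hβ0 : 0 < β) (h : β * s = 4) (w : W → ℝ) (x : W → Fin 2 → 𝕜)
    (hm : MomentsMatch 2 (scalarGaussian 𝕜) w x) (hκ : pairMoment w x = 24 * β ^ 3)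
    (lam : Fin (2 * n) → ℝ) :
    HasDetMoment 𝕜 2 n lam (β * s)
      (gammaConst n β 2 s * (12 / β) ^ n *
        ∑ A ∈ equipartitions 2 n, vdm lam (A 0) ^ 4 * vdm lam (A 1) ^ 4) := by
  have h1 := hasDetMoment_of_momentsMatch hn hβ hβ0 (k := 2) (by rw [h]; norm_num) w x hm lam
  -- Comparison with the unit vectors, where the moment is the sum over equipartitions, replaces the
  -- quadrature by a factor (24 β³ / 2)^n.
  have h2 := discreteMoment_four_universal w x (fun _ : Fin 2 => 1)
    (fun l => (Pi.single l 1 : Fin 2 → 𝕜)) n (fun i => lam (columnEquiv 2 n i))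
  rw [pairMoment_single, hκ, discreteMoment_single (by decide) (by norm_num)] at h2
  simp only [Fin.prod_univ_two] at h2
  have h3 : discreteMoment 4 w x (fun i => lam (columnEquiv 2 n i)) = (12 * β ^ 3) ^ n *
      ∑ A ∈ equipartitions 2 n, vdm lam (A 0) ^ 4 * vdm lam (A 1) ^ 4 := by
    have h4 : (24 * β ^ 3) ^ n = 2 ^ n * (12 * β ^ 3) ^ n := by rw [← mul_pow]; ring
    rw [h4, mul_assoc] at h2
    exact mul_left_cancel₀ (by positivity) h2
  rw [show 2 * 2 = 4 from rfl, h3] at h1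
  convert h1 using 1
  have h5 : (12 / β) ^ n = (β ^ (2 * (n * 2)))⁻¹ * (12 * β ^ 3) ^ n := by
    rw [show 2 * (n * 2) = 4 * n by ring, pow_mul, ← inv_pow, ← mul_pow]
    congr 1
    field_simp
  rw [h5]
  ring

end Moments

end BlockMoment

theorem theorem3p3 (β s : ℝ) (n : ℕ) (hn : 1 ≤ n) :
    (∀ r : ℕ, 2 ≤ r → β * s = 2 → ∀ lam : Fin (r * n) → ℝ,
      (β = 1 → BlockMoment.HasDetMoment ℝ r n lam (β * s)
        (BlockMoment.gammaConst n β r s *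
          ∑ A ∈ BlockMoment.equipartitions r n, ∏ j : Fin r, BlockMoment.vdm lam (A j) ^ 2)) ∧
      (β = 2 → BlockMoment.HasDetMoment ℂ r n lam (β * s)
        (BlockMoment.gammaConst n β r s *
          ∑ A ∈ BlockMoment.equipartitions r n, ∏ j : Fin r, BlockMoment.vdm lam (A j) ^ 2))) ∧
    (β * s = 4 → ∀ lam : Fin (2 * n) → ℝ,
      (β = 1 → BlockMoment.HasDetMoment ℝ 2 n lam (β * s)
        (BlockMoment.gammaConst n β 2 s * (12 / β) ^ n *
          ∑ A ∈ BlockMoment.equipartitions 2 n,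
            BlockMoment.vdm lam (A 0) ^ 4 * BlockMoment.vdm lam (A 1) ^ 4)) ∧
      (β = 2 → BlockMoment.HasDetMoment ℂ 2 n lam (β * s)
        (BlockMoment.gammaConst n β 2 s * (12 / β) ^ n *
          ∑ A ∈ BlockMoment.equipartitions 2 n,
            BlockMoment.vdm lam (A 0) ^ 4 * BlockMoment.vdm lam (A 1) ^ 4))) := by
  have hR : β = 1 → β = Module.finrank ℝ ℝ := by rintro rfl; simp
  have hC : β = 2 → β = Module.finrank ℝ ℂ := by
    rintro rfl
    rw [Complex.finrank_real_complex]
    norm_num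
  refine ⟨fun r _ h lam => ⟨fun hβ => ?_, fun hβ => ?_⟩, fun h lam => ⟨fun hβ => ?_, fun hβ => ?_⟩⟩
  · exact BlockMoment.hasDetMoment_two hn (hR hβ) (by rw [hβ]; norm_num) h lam
  · exact BlockMoment.hasDetMoment_two hn (hC hβ) (by rw [hβ]; norm_num) h lam
  · exact BlockMoment.hasDetMoment_four hn (hR hβ) (by rw [hβ]; norm_num) h _ _
      BlockMoment.momentsMatch_real (by rw [BlockMoment.pairMoment_real, hβ]; norm_num) lam
  · exact BlockMoment.hasDetMoment_four hn (hC hβ) (by rw [hβ]; norm_num) h _ _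
      BlockMoment.momentsMatch_complex (by rw [BlockMoment.pairMoment_complex, hβ]; norm_num) lam
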